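/- \textbf{Setting.} Let $n\ge 2$, $d\ge 1$. For $A\in\mathbb{R}_{\ge 0}^{n\times d}$ with rows $A_1,\dots,A_n$ let $A_{\max}$ be its largest entry and consider the packing LP $\max\{\mathbf 1^\top x : x\in\mathbb{R}^d_{\ge0},\ Ax\le \mathbf 1\}$; its optimal value, assumed to exist (that is, $A$ has no zero column), is $\mathrm{OPT}(A)$. Two matrices of the same size are neighbours if they differ in at most one row. A randomized algorithm $M$ is $(\epsilon,\delta)$-differentially private on a set of inputs if $\Pr[M(A)\in O]\le e^{\epsilon}\Pr[M(A')\in O]+\delta$ for all neighbouring inputs $A,A'$ in that set and every set $O$ of outcomes. For $U>0$ let $\mathcal D^U$ be the set of $r\in\mathbb{R}^n_{\ge 0}$ with $\sum_i r_i=1$ and $\max_i r_i\le U$, and let $\mathrm{smax}^U(z)=\max_{r\in\mathcal D^U}\big(\langle z,r\rangle-\sum_i r_i\ln r_i\big)$ (with $\mathrm{smax}^U\equiv 0$ if $\mathcal D^U=\emptyset$, i.e. if $nU<1$). \textbf{Algorithm.} The input is $A$ and the public parameters $S>0$, $\mathrm{OPT}>0$, $\alpha,\beta,\delta\in(0,1)$,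 $\epsilon>0$. Let $H=\frac{2d}{\alpha\,\mathrm{OPT}}$ with pre- and post-processing and $H=S$ without. Put $$T=\Big\lceil\tfrac{20H\,\mathrm{OPT}\ln n}{\alpha^2}\Big\rceil,\quad \epsilon'=\frac{\epsilon}{2\sqrt{T\ln(1/\delta)}},\quad s=\frac{60H\,\mathrm{OPT}\,(\ln d+\ln(T/\beta))}{\alpha\epsilon'},\quad U=\frac1s,\quad \eta=\frac{\alpha}{10H\,\mathrm{OPT}}.$$ With pre-processing, every entry $A_{ij}$ is first replaced by $\min\{A_{ij},H\}$. Start with $x_0=0$. For $t=0,\dots,T-1$ draw a coordinate $j\in\{1,\dots,d\}$ by the exponential mechanism with privacy parameter $\epsilon'$ for the score $Q(j)=-\langle\nabla\mathrm{smax}^U(\eta Ax_t),A\mathbf 1_j\rangle\,\mathrm{OPT}$ with sensitivity bound $\Delta=3H\,\mathrm{OPT}/s$, i.e. with probability proportional to $\exp(\epsilon' Q(j)/(2\Delta))$, and set $x_{t+1}=x_t+\mathrm{OPT}\cdot\mathbf 1_j$. Output $x=x_T/T$; with post-processing, every coordinate $x_j\le 2/H$ is first set to $0$. \textbf{Theorem.}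 1. \emph{Without pre- and post-processing.} For all $\epsilon_0,\kappa$ there is a constant $C>0$ such that the following holds for all $n\ge2$, $d\ge1$, $\alpha,\beta,\delta\in(0,1)$ and $0<\epsilon\le\min\{\epsilon_0,2\ln(1/\delta)\}$. For all fixed $S,\mathrm{OPT}>0$ the algorithm is $(\epsilon,\delta)$-differentially private on the set of matrices with entries in $[0,S]$. If $A\ge0$, $\mathrm{OPT}=\mathrm{OPT}(A)$ and $A_{\max}\le S\le\kappa A_{\max}$, then the output always satisfies $x\ge0$ and $\mathbf 1^\top x\ge(1-\alpha)\mathrm{OPT}$, and with probability at least $1-\beta$ the number of $i$ for which $A_ix\le1+\alpha$ fails is at most $s$ and at most $$C\cdot\frac{(A_{\max}\mathrm{OPT})^{1.5}\,\big(\ln d+\ln\frac{n}{\alpha\beta}\big)\sqrt{\ln n\,\ln\frac1\delta}}{\alpha^2\epsilon}.$$ 2. \emph{With pre- and post-processing.} There is an absolute constant $C>0$ such that the following holds for all $n\ge2$, $d\ge1$, $\alpha,\beta,\delta\in(0,1)$ and $\epsilon>0$. If $\epsilon\le2\ln(1/\delta)$, then for every fixed $\mathrm{OPT}>0$ the algorithm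 is $(\epsilon,\delta)$-differentially private on the set of all nonnegative matrices. If $A\ge0$ and $\mathrm{OPT}=\mathrm{OPT}(A)$, then the output always satisfies $x\ge0$ and $\mathbf 1^\top x\ge(1-\alpha)\mathrm{OPT}$, and with probability at least $1-\beta$ the number of $i$ for which $A_ix\le1+\alpha$ fails (for the original matrix $A$) is at most $s$ and at most $$C\cdot\frac{d^{1.5}\,\big(\ln d+\ln\frac{n}{\alpha\beta}\big)\sqrt{\ln n\,\ln\frac1\delta}}{\alpha^{3.5}\epsilon}.$$ -/

import Mathlib

open scoped ENNReal

noncomputable section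

namespace PackingLP

/-- `𝒟^U`: the probability vectors all of whose coordinates are at most `U`. -/
def cappedSimplex (n : ℕ) (U : ℝ) : Set (Fin n → ℝ) :=
  {r | r ∈ stdSimplex ℝ (Fin n) ∧ ∀ i, r i ≤ U}

/-- The truncated softmax `smax^U(z) = max_{r ∈ 𝒟^U} ⟨z, r⟩ - ∑ i, r i * log (r i)`
(with `0 * log 0 = 0`). If `n * U < 1` then `𝒟^U` is empty and the value is `0`. -/
def smax {n : ℕ} (U : ℝ) (z : Fin n → ℝ) : ℝ :=
  sSup ((fun r : Fin n → ℝ => z ⬝ᵥ r - ∑ i, r i * Real.log (r i)) '' cappedSimplex n U)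

/-- The truncated-softmax weights `∇ smax^U(z)`. If `𝒟^U` is empty they are all `0`. -/
def gradSmax {n : ℕ} (U : ℝ) (z : Fin n → ℝ) (i : Fin n) : ℝ :=
  fderiv ℝ (smax U) z (Pi.single i 1)

/-- The exponential mechanism with privacy parameter `ε` for a score function `Q` on a finite
set whose sensitivity is at most `Δ`: the candidate `j` is chosen with probability proportional
to `exp (ε * Q j / (2 * Δ))`. -/
def expMechanism {ι : Type*} [Fintype ι] [Nonempty ι] (ε Δ : ℝ) (Q : ι → ℝ) : PMF ι :=
  PMF.normalize (fun j => ENNReal.ofReal (Real.exp (ε * Q j / (2 * Δ))))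
    (by
      obtain ⟨j⟩ := ‹Nonempty ι›
      intro h
      have := ENNReal.tsum_eq_zero.mp h j
      rw [ENNReal.ofReal_eq_zero] at this
      exact absurd this (not_le.mpr (Real.exp_pos _)))
    (by
      rw [tsum_fintype]
      exact ENNReal.sum_ne_top.mpr fun _ _ => ENNReal.ofReal_ne_top)

/-- The public input of the algorithm, i.e. everything but the constraint matrix: a bound `S`
for the entries, the optimal value `opt`, the accuracy parameters `α`, `β`, the privacy
parameters `ε`, `δ`, and whether pre- and post-processing are executed. -/
structure Params where
  S : ℝ
  opt : ℝ
  α : ℝ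
  β : ℝ
  ε : ℝ
  δ : ℝ
  processing : Bool

namespace Params

/-- The bound `H` on the entries of the matrix with which the iterations work. -/
def H (P : Params) (d : ℕ) : ℝ :=
  if P.processing then 2 * d / (P.α * P.opt) else P.S

/-- The number of iterations (rounded up to an integer). -/
def T (P : Params) (n d : ℕ) : ℕ :=
  ⌈20 * P.H d * P.opt * Real.log n / P.α ^ 2⌉₊

/-- The privacy parameter `ε'` of a single iteration. -/
def stepε (P : Params) (n d : ℕ) : ℝ :=
  P.ε / (2 * √(P.T n d * Real.log (1 / P.δ)))

def s (P : Params) (n d : ℕ) : ℝ :=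
  60 * P.H d * P.opt * (Real.log d + Real.log (P.T n d / P.β)) / (P.α * P.stepε n d)

def U (P : Params) (n d : ℕ) : ℝ :=
  1 / P.s n d

def η (P : Params) (d : ℕ) : ℝ :=
  P.α / (10 * P.H d * P.opt)

/-- The bound `3 * H * opt / s` on the sensitivity of the score function to which the exponential
mechanism is calibrated. -/
def sensitivity (P : Params) (n d : ℕ) : ℝ :=
  3 * P.H d * P.opt / P.s n d

end Params

/-- The optional pre-processing: clip every entry at `H`. -/
def preprocess {n d : ℕ} (P : Params) (A : Matrix (Fin n) (Fin d) ℝ) : Matrix (Fin n) (Fin d) ℝ :=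
  if P.processing then A.map (fun a => min a (P.H d)) else A

/-- The optional post-processing: set to zero every coordinate that is at most `2 / H`. -/
def postprocess {d : ℕ} (P : Params) (x : Fin d → ℝ) : Fin d → ℝ :=
  if P.processing then fun j => if x j ≤ 2 / P.H d then 0 else x j else x

/-- The score `Q(j) = -⟨∇ smax^U(η A x), A 1_j⟩ * opt`. -/
def score {n d : ℕ} (P : Params) (A : Matrix (Fin n) (Fin d) ℝ) (x : Fin d → ℝ) (j : Fin d) : ℝ :=
  -(gradSmax (P.U n d) (P.η d • A.mulVec x) ⬝ᵥ A.col j) * P.opt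

/-- The packing oracle: the random update `Δ = 1_j * opt`. -/
def oracle {n d : ℕ} [NeZero d] (P : Params) (A : Matrix (Fin n) (Fin d) ℝ) (x : Fin d → ℝ) :
    PMF (Fin d → ℝ) :=
  (expMechanism (P.stepε n d) (P.sensitivity n d) (score P A x)).map fun j => Pi.single j P.opt

/-- The law of the iterate `x_t`. -/
def iterate {n d : ℕ} [NeZero d] (P : Params) (A : Matrix (Fin n) (Fin d) ℝ) :
    ℕ → PMF (Fin d → ℝ)
  | 0 => PMF.pure 0
  | t + 1 => (iterate P A t).bind fun x => (oracle P A x).map fun Δ => x + Δ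

/-- The law of the output of the private algorithm for packing linear programs. -/
def algorithm {n d : ℕ} [NeZero d] (P : Params) (A : Matrix (Fin n) (Fin d) ℝ) :
    PMF (Fin d → ℝ) :=
  (iterate P (preprocess P A) (P.T n d)).map fun x => postprocess P ((P.T n d : ℝ)⁻¹ • x)

/-- Two constraint matrices are neighbours if they differ in at most one row. -/
def Neighbor {n d : ℕ} (A A' : Matrix (Fin n) (Fin d) ℝ) : Prop :=
  ∃ i, ∀ k, k ≠ i → A k = A' k

/-- `(ε, δ)`-differential privacy of a randomized algorithm on the inputs in `D`. -/
def DifferentiallyPrivate {n d : ℕ} {Ω : Type*} (ε δ : ℝ) (D : Set (Matrix (Fin n) (Fin d) ℝ))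
    (M : Matrix (Fin n) (Fin d) ℝ → PMF Ω) : Prop :=
  ∀ A ∈ D, ∀ A' ∈ D, Neighbor A A' → ∀ O : Set Ω,
    (M A).toOuterMeasure O ≤
      ENNReal.ofReal (Real.exp ε) * (M A').toOuterMeasure O + ENNReal.ofReal δ

/-- `v` is the optimal value of `max 1ᵀx` subject to `x ≥ 0`, `A x ≤ 1`. -/
def IsOpt {n d : ℕ} (A : Matrix (Fin n) (Fin d) ℝ) (v : ℝ) : Prop :=
  IsGreatest ((fun x : Fin d → ℝ => ∑ j, x j) ''
    {x | (∀ j, 0 ≤ x j) ∧ ∀ i, A.mulVec x i ≤ 1}) v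

/-- The largest entry of `A`. -/
def maxEntry {n d : ℕ} (A : Matrix (Fin n) (Fin d) ℝ) : ℝ :=
  ⨆ p : Fin n × Fin d, A p.1 p.2

/-- The number of constraints `A_i x ≤ 1 + α` that fail. -/
def numViolated {n d : ℕ} (A : Matrix (Fin n) (Fin d) ℝ) (α : ℝ) (x : Fin d → ℝ) : ℕ :=
  {i | 1 + α < A.mulVec x i}.ncard

end PackingLP

end

/-! The iteration is a multiplicative-weights scheme with potential `smax U`, whose gradient is the
weight vector min(U, c·exp(z i)) (`hasFDerivAt_smax`). The cap U = 1/s serves both privacy and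
accuracy.

Privacy: changing row i moves all other weights in one direction, by at most U in total
(`sum_abs_sub_erase_le`). The scores therefore change by O(H·opt·U), and each draw of the
exponential mechanism is ε'-private. `chain_toOuterMeasure_le` composes the T draws by bounding
exponential moments of the accumulated privacy loss.

Accuracy: the optimal solution is feasible, so under the current weights some column costs at most
1/opt. A union bound over the draws keeps the growth of the potential per step close to η. If more
than s constraints failed, the uniform distribution on them would respect the cap and force the
potential up to ηT(1+α), which is too large because log n ≤ ηTα/2
(`numViolated_le_of_potentialBound`). If nU < 1, then s > n and the bound by s is trivial.

Processing makes H independent of the entries of A: zeroing small coordinates costs at most d·2/H =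
α·opt, and a row violated afterwards is already violated for the clipped matrix
(`numViolated_postprocess_le`). What remains is to estimate s. -/

namespace PackingLP

/-! ### Truncated softmax: maximiser, stability and derivative -/

/-- The weights `min U (c * exp z)`, with `c` chosen so that they add up to one. -/
structure IsTruncatedSoftmax {n : ℕ} (U : ℝ) (z y : Fin n → ℝ) (c : ℝ) : Prop where
  pos : 0 < c
  eq_min : ∀ i, y i = min U (c * Real.exp (z i))
  sum_eq : ∑ i, y i = 1

lemma exists_isTruncatedSoftmax {n : ℕ} {U : ℝ} (hU : 0 < U) (hn : 1 ≤ n * U) (z : Fin n → ℝ) :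
    ∃ y c, IsTruncatedSoftmax U z y c := by
  let f : ℝ → ℝ := fun c => ∑ i, min U (c * Real.exp (z i))
  -- At c = C every weight reaches the cap, so the total mass is nU ≥ 1; the intermediate value
  -- theorem applies between 0 and C.
  let C : ℝ := ∑ i, U * Real.exp (-z i)
  have hC : 0 ≤ C := Finset.sum_nonneg fun i _ => by positivity
  have hf : ContinuousOn f (Set.Icc 0 C) := by fun_prop
  have hf0 : f 0 = 0 := by simp [f, hU.le]
  have hfC : f C = n * U := by
    have : ∀ i, min U (C * Real.exp (z i)) = U := fun i => by
      apply min_eq_left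
      have h1 : U * Real.exp (-z i) ≤ C :=
        Finset.single_le_sum (f := fun i => U * Real.exp (-z i)) (fun i _ => by positivity)
          (Finset.mem_univ i)
      calc U = U * Real.exp (-z i) * Real.exp (z i) := by
            rw [mul_assoc, ← Real.exp_add]; simp
        _ ≤ _ := by gcongr
    simp [f, this]
  obtain ⟨c, hc, hc1⟩ := intermediate_value_Icc hC hf
    (show (1 : ℝ) ∈ Set.Icc (f 0) (f C) by rw [hf0, hfC]; exact ⟨zero_le_one, hn⟩)
  refine ⟨fun i => min U (c * Real.exp (z i)), c, ?_, fun _ => rfl, hc1⟩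
  rcases hc.1.lt_or_eq with h | h
  · exact h
  · rw [← h, hf0] at hc1
    norm_num at hc1

/-- The tangent line of the convex function `r * log r`. -/
lemma tangent_le_mul_log {r y : ℝ} (hr : 0 ≤ r) (hy : 0 < y) :
    y * Real.log y + (1 + Real.log y) * (r - y) ≤ r * Real.log r := by
  rcases hr.eq_or_lt with rfl | hr
  · nlinarith
  · have h := Real.log_le_sub_one_of_pos (div_pos hy hr)
    rw [Real.log_div hy.ne' hr.ne'] at h
    have h2 : r * (Real.log y - Real.log r) ≤ r * (y / r - 1) := by gcongr
    have h3 : r * (y / r - 1) = y - r := by field_simp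
    nlinarith

namespace IsTruncatedSoftmax

variable {n : ℕ} {U : ℝ} {z z' y y' : Fin n → ℝ} {c c' : ℝ}

lemma apply_pos (h : IsTruncatedSoftmax U z y c) (hU : 0 < U) (i : Fin n) : 0 < y i := by
  rw [h.eq_min]
  exact lt_min hU (mul_pos h.pos (Real.exp_pos _))

lemma apply_le (h : IsTruncatedSoftmax U z y c) (i : Fin n) : y i ≤ U := by
  rw [h.eq_min]
  exact min_le_left _ _

lemma mem_cappedSimplex (h : IsTruncatedSoftmax U z y c) (hU : 0 < U) :
    y ∈ cappedSimplex n U :=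
  ⟨⟨fun i => (h.apply_pos hU i).le, h.sum_eq⟩, h.apply_le⟩

lemma isGreatest (h : IsTruncatedSoftmax U z y c) (hU : 0 < U) :
    IsGreatest ((fun r : Fin n → ℝ => z ⬝ᵥ r - ∑ i, r i * Real.log (r i)) '' cappedSimplex n U)
      (z ⬝ᵥ y - ∑ i, y i * Real.log (y i)) := by
  refine ⟨⟨y, h.mem_cappedSimplex hU, rfl⟩, ?_⟩
  rintro _ ⟨r, ⟨⟨hr0, hr1⟩, hrU⟩, rfl⟩
  -- Lagrangian optimality, one coordinate at a time: log c + 1 comes from the constraint that the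
  -- mass is one, so its term vanishes after summation. In `h2`, a saturated coordinate has r i ≤ y
  -- i and a factor of the right sign; otherwise the factor is zero.
  have key : ∀ i, z i * r i - r i * Real.log (r i) ≤
      z i * y i - y i * Real.log (y i) - (Real.log c + 1) * (r i - y i) := fun i => by
    have h1 := tangent_le_mul_log (hr0 i) (h.apply_pos hU i)
    have h2 : 0 ≤ (z i - Real.log (y i) + Real.log c) * (y i - r i) := by
      have hl : Real.log (c * Real.exp (z i)) = Real.log c + z i := by
        rw [Real.log_mul h.pos.ne' (Real.exp_pos _).ne', Real.log_exp]
      rcases le_total U (c * Real.exp (z i)) with hle | hle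
      · have hy : y i = U := by rw [h.eq_min, min_eq_left hle]
        have := Real.log_le_log hU hle
        rw [hy]
        exact mul_nonneg (by linarith) (by linarith [hrU i])
      · have hy : y i = c * Real.exp (z i) := by rw [h.eq_min, min_eq_right hle]
        have : z i - Real.log (y i) + Real.log c = 0 := by rw [hy, hl]; ring
        rw [this, zero_mul]
    nlinarith
  have hsum := Finset.sum_le_sum fun i (_ : i ∈ Finset.univ) => key i
  simp only [Finset.sum_sub_distrib, ← Finset.mul_sum, hr1, h.sum_eq] at hsum
  simp only [dotProduct]
  linarith

lemma smax_eq (h : IsTruncatedSoftmax U z y c) (hU : 0 < U) :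
    smax U z = z ⬝ᵥ y - ∑ i, y i * Real.log (y i) :=
  (h.isGreatest hU).csSup_eq

lemma le_smax (h : IsTruncatedSoftmax U z y c) (hU : 0 < U) {r : Fin n → ℝ}
    (hr : r ∈ cappedSimplex n U) : z ⬝ᵥ r - ∑ i, r i * Real.log (r i) ≤ smax U z := by
  rw [h.smax_eq hU]
  exact (h.isGreatest hU).2 ⟨r, hr, rfl⟩

/-- `y'` is a subgradient of `smax U` at `z'`. -/
lemma smax_le_add (h : IsTruncatedSoftmax U z y c) (h' : IsTruncatedSoftmax U z' y' c')
    (hU : 0 < U) : smax U z' ≤ smax U z + (z' - z) ⬝ᵥ y' := by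
  have := h.le_smax hU (h'.mem_cappedSimplex hU)
  rw [h'.smax_eq hU, sub_dotProduct]
  linarith

lemma le_of_factor_le (h : IsTruncatedSoftmax U z y c) (h' : IsTruncatedSoftmax U z' y' c')
    {i : Fin n} (hi : c * Real.exp (z i) ≤ c' * Real.exp (z' i)) : y i ≤ y' i := by
  rw [h.eq_min, h'.eq_min]
  exact min_le_min le_rfl hi

/-- If the normaliser grows by at most exp b, the formula for the weights gives the factor directly.
If it grows more, no weight decreases, and since both vectors have mass one they coincide. -/
lemma le_exp_mul (h : IsTruncatedSoftmax U z y c) (h' : IsTruncatedSoftmax U z' y' c')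
    (hU : 0 < U) {a b : ℝ} (hab : 0 ≤ a + b) (hza : ∀ i, z' i ≤ z i + a)
    (hzb : ∀ i, z i ≤ z' i + b) (i : Fin n) : y' i ≤ Real.exp (a + b) * y i := by
  have hexp : 1 ≤ Real.exp (a + b) := Real.one_le_exp hab
  rcases le_total c' (c * Real.exp b) with hc | hc
  · rw [h.eq_min, h'.eq_min, mul_min_of_nonneg _ _ (Real.exp_pos _).le]
    refine min_le_min (by nlinarith) ?_
    calc c' * Real.exp (z' i) ≤ (c * Real.exp b) * Real.exp (z i + a) := by
          gcongr
          · exact mul_nonneg h.pos.le (Real.exp_pos _).le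
          · exact hza i
      _ = _ := by rw [Real.exp_add, Real.exp_add]; ring
  · have hle : ∀ k, y k ≤ y' k := fun k => by
      refine h.le_of_factor_le h' ?_
      calc c * Real.exp (z k) ≤ c * Real.exp (z' k + b) := by
            have := h.pos
            gcongr
            exact hzb k
        _ = (c * Real.exp b) * Real.exp (z' k) := by rw [Real.exp_add]; ring
        _ ≤ _ := by gcongr
    have heq := (Finset.sum_eq_sum_iff_of_le fun k _ => hle k).mp (h.sum_eq.trans h'.sum_eq.symm)
      i (Finset.mem_univ i)
    rw [← heq]
    nlinarith [h.apply_pos hU i]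

/-- Continuity of the weights in z, which upgrades the subgradient to a derivative. -/
lemma sum_abs_sub_le (h : IsTruncatedSoftmax U z y c) (h' : IsTruncatedSoftmax U z' y' c')
    (hU : 0 < U) : ∑ i, |y' i - y i| ≤ 2 * (Real.exp (2 * ‖z' - z‖) - 1) := by
  have hz : ∀ i, |z' i - z i| ≤ ‖z' - z‖ := fun i => norm_le_pi_norm (z' - z) i
  have h1 := h.le_exp_mul h' hU (a := ‖z' - z‖) (b := ‖z' - z‖) (by positivity)
    (fun i => by linarith [(abs_le.mp (hz i)).2]) (fun i => by linarith [(abs_le.mp (hz i)).1])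
  have h2 := h'.le_exp_mul h hU (a := ‖z' - z‖) (b := ‖z' - z‖) (by positivity)
    (fun i => by linarith [(abs_le.mp (hz i)).1]) (fun i => by linarith [(abs_le.mp (hz i)).2])
  rw [← two_mul] at h1 h2
  set e := Real.exp (2 * ‖z' - z‖)
  have he : 1 ≤ e := Real.one_le_exp (by positivity)
  calc ∑ i, |y' i - y i| ≤ ∑ i, (e - 1) * (y i + y' i) := by
        refine Finset.sum_le_sum fun i _ => abs_le.mpr ⟨?_, ?_⟩
        · nlinarith [h2 i, h.apply_pos hU i]
        · nlinarith [h1 i, h'.apply_pos hU i]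
    _ = 2 * (e - 1) := by
        rw [← Finset.mul_sum, Finset.sum_add_distrib, h.sum_eq, h'.sum_eq]; ring

/-- The subgradient inequalities at z and at w sandwich the increment; the gap ⟨w - z, v - y⟩ is
o(‖w - z‖) because the weights are continuous. -/
lemma hasFDerivAt_smax (h : IsTruncatedSoftmax U z y c) (hU : 0 < U) (hn : 1 ≤ n * U) :
    HasFDerivAt (smax U)
      (∑ i, y i • (ContinuousLinearMap.proj i : (Fin n → ℝ) →L[ℝ] ℝ)) z := by
  rw [hasFDerivAt_iff_isLittleO, Asymptotics.isLittleO_iff]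
  intro ε hε
  have hlim : Filter.Tendsto (fun w : Fin n → ℝ => 2 * (Real.exp (2 * ‖w - z‖) - 1)) (nhds z)
      (nhds 0) := by
    have : Continuous (fun w : Fin n → ℝ => 2 * (Real.exp (2 * ‖w - z‖) - 1)) := by fun_prop
    simpa using this.tendsto z
  filter_upwards [hlim.eventually_lt_const hε] with w hw
  obtain ⟨v, b, hv⟩ := exists_isTruncatedSoftmax hU hn w
  have happ : (∑ i, y i • (ContinuousLinearMap.proj i : (Fin n → ℝ) →L[ℝ] ℝ)) (w - z)
      = (w - z) ⬝ᵥ y := by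
    simp [dotProduct, mul_comm]
  rw [happ]
  have h1 := h.smax_le_add hv hU
  have h2 := hv.smax_le_add h hU
  have h3 : (w - z) ⬝ᵥ v - (w - z) ⬝ᵥ y ≤ ε * ‖w - z‖ := by
    rw [← dotProduct_sub]
    calc (w - z) ⬝ᵥ (v - y) ≤ ∑ i, ‖w - z‖ * |v i - y i| := by
          refine Finset.sum_le_sum fun i _ => ?_
          calc (w - z) i * (v - y) i ≤ |(w - z) i| * |(v - y) i| := by
                rw [← abs_mul]; exact le_abs_self _
            _ ≤ _ :=
                mul_le_mul (norm_le_pi_norm (w - z) i) le_rfl (abs_nonneg _) (norm_nonneg _)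
      _ = (∑ i, |v i - y i|) * ‖w - z‖ := by rw [← Finset.mul_sum, mul_comm]
      _ ≤ ε * ‖w - z‖ := by
          gcongr
          exact (h.sum_abs_sub_le hv hU).trans hw.le
  have h4 : (z - w) ⬝ᵥ y = -((w - z) ⬝ᵥ y) := by rw [← neg_dotProduct, neg_sub]
  rw [Real.norm_eq_abs, abs_le]
  constructor
  · have : 0 ≤ ε * ‖w - z‖ := by positivity
    linarith
  · linarith

lemma gradSmax_eq (h : IsTruncatedSoftmax U z y c) (hU : 0 < U) (hn : 1 ≤ n * U) :
    gradSmax U z = y := by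
  funext i
  rw [gradSmax, (h.hasFDerivAt_smax hU hn).fderiv]
  simp [Pi.single_apply]

/-- If two vectors differ in the coordinate `i` only, then the weights of the other coordinates
all move in the same direction, and by at most `U` in total. -/
lemma sum_abs_sub_erase_le (h : IsTruncatedSoftmax U z y c)
    (h' : IsTruncatedSoftmax U z' y' c') (hU : 0 < U) {i : Fin n}
    (hz : ∀ k, k ≠ i → z k = z' k) : ∑ k ∈ Finset.univ.erase i, |y k - y' k| ≤ U := by
  wlog hc : c ≤ c' generalizing z z' y y' c c'
  · have := this h' h (fun k hk => (hz k hk).symm) (le_of_not_ge hc)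
    simpa only [abs_sub_comm] using this
  have hle : ∀ k ∈ Finset.univ.erase i, |y k - y' k| = y' k - y k := fun k hk => by
    rw [abs_sub_comm, abs_of_nonneg]
    refine sub_nonneg.mpr (h.le_of_factor_le h' ?_)
    rw [hz k (Finset.ne_of_mem_erase hk)]
    gcongr
  rw [Finset.sum_congr rfl hle, Finset.sum_sub_distrib]
  -- Mass is conserved, so the total gain off i is the loss y i - y' i at i, which is at most U.
  have e1 := Finset.add_sum_erase Finset.univ y (Finset.mem_univ i)
  have e2 := Finset.add_sum_erase Finset.univ y' (Finset.mem_univ i)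
  rw [h.sum_eq] at e1
  rw [h'.sum_eq] at e2
  linarith [h.apply_le i, h'.apply_pos hU i]

end IsTruncatedSoftmax

lemma smax_eq_zero_of_lt {n : ℕ} {U : ℝ} (hn : n * U < 1) (z : Fin n → ℝ) : smax U z = 0 := by
  have : cappedSimplex n U = ∅ := by
    refine Set.eq_empty_of_forall_notMem fun r hr => ?_
    have := Finset.sum_le_sum fun i (_ : i ∈ Finset.univ) => hr.2 i
    rw [hr.1.2] at this
    simp only [Finset.sum_const, Finset.card_univ, Fintype.card_fin, nsmul_eq_mul] at this
    linarith
  -- The supremum of the empty set of reals is 0 by convention.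
  simp [smax, this]

lemma gradSmax_eq_zero_of_lt {n : ℕ} {U : ℝ} (hn : n * U < 1) (z : Fin n → ℝ) :
    gradSmax U z = 0 := by
  have : smax (n := n) U = fun _ => 0 := funext (smax_eq_zero_of_lt hn)
  funext i
  simp [gradSmax, this]

/-! ### Growth and sensitivity of the potential -/

section Potential

variable {n : ℕ} {U : ℝ}

lemma gradSmax_mem_cappedSimplex (hU : 0 < U) (hn : 1 ≤ n * U) (z : Fin n → ℝ) :
    gradSmax U z ∈ cappedSimplex n U := by
  obtain ⟨y, c, h⟩ := exists_isTruncatedSoftmax hU hn z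
  rw [h.gradSmax_eq hU hn]
  exact h.mem_cappedSimplex hU

lemma le_smax (hU : 0 < U) (hn : 1 ≤ n * U) (z : Fin n → ℝ) {r : Fin n → ℝ}
    (hr : r ∈ cappedSimplex n U) : z ⬝ᵥ r - ∑ i, r i * Real.log (r i) ≤ smax U z := by
  obtain ⟨y, c, h⟩ := exists_isTruncatedSoftmax hU hn z
  exact h.le_smax hU hr

/-- The subgradient at z + h bounds the increment using the new weights; as h lies in [0, a], these
exceed the old ones by at most the factor exp a. -/
lemma smax_add_le (hU : 0 < U) (hn : 1 ≤ n * U) (z h : Fin n → ℝ) {a : ℝ} (ha : 0 ≤ a)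
    (h0 : ∀ i, 0 ≤ h i) (h1 : ∀ i, h i ≤ a) :
    smax U (z + h) ≤ smax U z + Real.exp a * (gradSmax U z ⬝ᵥ h) := by
  obtain ⟨y, c, hy⟩ := exists_isTruncatedSoftmax hU hn z
  obtain ⟨y', c', hy'⟩ := exists_isTruncatedSoftmax hU hn (z + h)
  rw [hy.gradSmax_eq hU hn]
  have h2 := hy.smax_le_add hy' hU
  have h3 := hy.le_exp_mul hy' hU (a := a) (b := 0) (by simpa using ha)
    (fun i => by simpa using h1 i) (fun i => by simpa using h0 i)
  rw [add_zero] at h3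
  rw [add_sub_cancel_left] at h2
  refine h2.trans (add_le_add le_rfl ?_)
  rw [dotProduct, dotProduct, Finset.mul_sum]
  refine Finset.sum_le_sum fun i _ => ?_
  nlinarith [h3 i, h0 i]

lemma smax_zero_le (hU : 0 < U) (hn : 1 ≤ n * U) : smax U (0 : Fin n → ℝ) ≤ Real.log n := by
  obtain ⟨y, c, hy⟩ := exists_isTruncatedSoftmax hU hn (0 : Fin n → ℝ)
  have hn0 : (0 : ℝ) < n := by
    rcases (Nat.cast_nonneg (α := ℝ) n).eq_or_lt with h | h
    · rw [← h] at hn; norm_num at hn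
    · exact h
  rw [hy.smax_eq hU, zero_dotProduct, zero_sub, ← Finset.sum_neg_distrib]
  -- The tangent to r log r at r = 1/n: entropy is maximal at the uniform distribution.
  have key : ∀ i, -(y i * Real.log (y i)) ≤ (n : ℝ)⁻¹ - y i + Real.log n * y i := fun i => by
    have h := tangent_le_mul_log (hy.apply_pos hU i).le (inv_pos.mpr hn0)
    rw [Real.log_inv] at h
    nlinarith
  refine (Finset.sum_le_sum fun i _ => key i).trans_eq ?_
  rw [Finset.sum_add_distrib, Finset.sum_sub_distrib, ← Finset.mul_sum, hy.sum_eq]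
  simp [hn0.ne']

/-- The changed row contributes at most HU since both of its terms lie in [0, HU]; the other rows
contribute at most H times the total movement of their weights, again HU. -/
lemma abs_gradSmax_dotProduct_sub_le (hU : 0 < U) {H : ℝ} (hH : 0 ≤ H) {z z' a a' : Fin n → ℝ}
    {i : Fin n} (hz : ∀ k, k ≠ i → z k = z' k) (ha : ∀ k, k ≠ i → a k = a' k)
    (h0 : ∀ k, 0 ≤ a k) (h1 : ∀ k, a k ≤ H) (h0' : ∀ k, 0 ≤ a' k) (h1' : ∀ k, a' k ≤ H) :
    |gradSmax U z ⬝ᵥ a - gradSmax U z' ⬝ᵥ a'| ≤ 3 * H * U := by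
  rcases lt_or_ge (n * U) 1 with hn | hn
  · rw [gradSmax_eq_zero_of_lt hn, gradSmax_eq_zero_of_lt hn]
    simp only [zero_dotProduct, sub_self, abs_zero]
    positivity
  obtain ⟨y, c, hy⟩ := exists_isTruncatedSoftmax hU hn z
  obtain ⟨y', c', hy'⟩ := exists_isTruncatedSoftmax hU hn z'
  rw [hy.gradSmax_eq hU hn, hy'.gradSmax_eq hU hn, dotProduct, dotProduct, ← Finset.sum_sub_distrib,
    ← Finset.add_sum_erase Finset.univ _ (Finset.mem_univ i)]
  refine (abs_add_le _ _).trans ?_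
  have hi : |y i * a i - y' i * a' i| ≤ H * U := by
    have e1 : y i * a i ≤ U * H :=
      mul_le_mul (hy.apply_le i) (h1 i) (h0 i) hU.le
    have e2 : y' i * a' i ≤ U * H :=
      mul_le_mul (hy'.apply_le i) (h1' i) (h0' i) hU.le
    have e3 := mul_nonneg (hy.apply_pos hU i).le (h0 i)
    have e4 := mul_nonneg (hy'.apply_pos hU i).le (h0' i)
    rw [abs_le]
    constructor <;> linarith
  have hrest : |∑ k ∈ Finset.univ.erase i, (y k * a k - y' k * a' k)| ≤ H * U :=
    calc _ ≤ ∑ k ∈ Finset.univ.erase i, |y k * a k - y' k * a' k| :=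
          Finset.abs_sum_le_sum_abs _ _
      _ ≤ ∑ k ∈ Finset.univ.erase i, H * |y k - y' k| := by
          refine Finset.sum_le_sum fun k hk => ?_
          rw [← ha k (Finset.ne_of_mem_erase hk), ← sub_mul, abs_mul, abs_of_nonneg (h0 k),
            mul_comm]
          gcongr
          exact h1 k
      _ ≤ H * U := by
          rw [← Finset.mul_sum]
          gcongr
          exact hy.sum_abs_sub_erase_le hy' hU hz
  have : 0 ≤ H * U := by positivity
  linarith

end Potential

/-! ### Expectations under discrete laws -/

section Expectation

variable {α β : Type*}

/-- The expectation of a nonnegative function. -/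
noncomputable def expect (p : PMF α) (f : α → ℝ≥0∞) : ℝ≥0∞ := ∑' a, p a * f a

lemma expect_mono (p : PMF α) {f g : α → ℝ≥0∞} (h : ∀ a, f a ≤ g a) : expect p f ≤ expect p g :=
  ENNReal.tsum_le_tsum fun a => mul_le_mul_right (h a) _

lemma expect_const (p : PMF α) (c : ℝ≥0∞) : expect p (fun _ => c) = c := by
  rw [expect, ENNReal.tsum_mul_right, p.tsum_coe, one_mul]

lemma expect_add (p : PMF α) (f g : α → ℝ≥0∞) :
    expect p (fun a => f a + g a) = expect p f + expect p g := by
  simp_rw [expect, mul_add, ENNReal.tsum_add]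

lemma expect_const_mul (p : PMF α) (c : ℝ≥0∞) (f : α → ℝ≥0∞) :
    expect p (fun a => c * f a) = c * expect p f := by
  simp_rw [expect, mul_left_comm _ c, ENNReal.tsum_mul_left]

lemma expect_pure (a : α) (f : α → ℝ≥0∞) : expect (PMF.pure a) f = f a := by
  rw [expect, tsum_eq_single a]
  · simp
  · intro b hb
    simp [PMF.pure_apply_of_ne _ _ hb]

lemma expect_bind (p : PMF α) (k : α → PMF β) (f : β → ℝ≥0∞) :
    expect (p.bind k) f = expect p fun a => expect (k a) f := by
  simp_rw [expect, PMF.bind_apply, ← ENNReal.tsum_mul_right, ← ENNReal.tsum_mul_left]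
  rw [ENNReal.tsum_comm]
  simp_rw [mul_assoc]

lemma expect_map (p : PMF α) (g : α → β) (f : β → ℝ≥0∞) :
    expect (p.map g) f = expect p fun a => f (g a) := by
  rw [← PMF.bind_pure_comp, expect_bind]
  simp_rw [Function.comp_apply, expect_pure]

lemma toOuterMeasure_eq_expect (p : PMF α) (O : Set α) :
    p.toOuterMeasure O = expect p (O.indicator 1) := by
  rw [PMF.toOuterMeasure_apply, expect]
  refine tsum_congr fun a => ?_
  by_cases h : a ∈ O <;> simp [h]

end Expectation

/-! ### Privacy loss of a single draw -/

section Loss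

variable {ι : Type*}

lemma toReal_apply_pos {p : PMF ι} {j : ι} (h : p j ≠ 0) : 0 < (p j).toReal :=
  ENNReal.toReal_pos h (p.apply_ne_top j)

/-- The privacy loss of the outcome `j`. -/
noncomputable def loss (p q : PMF ι) (j : ι) : ℝ := Real.log ((p j).toReal / (q j).toReal)

lemma loss_comm (p q : PMF ι) (j : ι) : loss q p j = -loss p q j := by
  rw [loss, loss, ← Real.log_inv, inv_div]

/-- Reweighting by the privacy loss turns expectations under `p` into expectations under `q`. -/
lemma expect_mul_exp_neg_loss {p q : PMF ι} (hp : ∀ j, p j ≠ 0) (hq : ∀ j, q j ≠ 0)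
    (f : ι → ℝ≥0∞) :
    expect p (fun j => f j * ENNReal.ofReal (Real.exp (-loss p q j))) = expect q f := by
  refine tsum_congr fun j => ?_
  have hpj := toReal_apply_pos (hp j)
  have hqj := toReal_apply_pos (hq j)
  have : p j * ENNReal.ofReal (Real.exp (-loss p q j)) = q j := by
    conv_lhs => rw [← ENNReal.ofReal_toReal (p.apply_ne_top j)]
    conv_rhs => rw [← ENNReal.ofReal_toReal (q.apply_ne_top j)]
    rw [← ENNReal.ofReal_mul hpj.le, loss, Real.exp_neg, Real.exp_log (div_pos hpj hqj)]
    congr 1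
    field_simp
  rw [← this]
  ring

variable [Fintype ι]

lemma sum_toReal (p : PMF ι) : ∑ j, (p j).toReal = 1 := by
  rw [← ENNReal.toReal_sum fun j _ => p.apply_ne_top j, ← tsum_fintype (L := .unconditional _),
    p.tsum_coe, ENNReal.toReal_one]

/-- Hoeffding's lemma for a distribution on a finite set. -/
lemma sum_mul_exp_le (p : PMF ι) {X : ι → ℝ} {e : ℝ} (hX : ∀ j, |X j| ≤ e) (t : ℝ) :
    ∑ j, (p j).toReal * Real.exp (t * X j) ≤
      Real.exp (t * ∑ j, (p j).toReal * X j + e ^ 2 * t ^ 2 / 2) := by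
  let _ : MeasurableSpace ι := ⊤
  have h := (ProbabilityTheory.hasSubgaussianMGF_of_mem_Icc (μ := p.toMeasure) (X := X)
    (a := -e) (b := e) (measurable_of_finite X).aemeasurable
    (Filter.Eventually.of_forall fun j => abs_le.mp (hX j))).mgf_le t
  have hc : (((‖e - -e‖₊ / 2) ^ 2 : NNReal) : ℝ) = e ^ 2 := by
    push_cast
    rw [Real.norm_eq_abs, div_pow, sq_abs]
    ring
  rw [ProbabilityTheory.mgf, PMF.integral_eq_sum, PMF.integral_eq_sum, hc] at h
  simp only [smul_eq_mul] at h
  set m := ∑ j, (p j).toReal * X j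
  rw [Real.exp_add]
  calc ∑ j, (p j).toReal * Real.exp (t * X j)
      = Real.exp (t * m) * ∑ j, (p j).toReal * Real.exp (t * (X j - m)) := by
        rw [Finset.mul_sum]
        refine Finset.sum_congr rfl fun j _ => ?_
        rw [mul_sub, Real.exp_sub]
        field_simp
    _ ≤ _ := by gcongr

/-- Hoeffding at t = -1, where the left side equals one, shows that the mean loss is at most e²/2.
Inserting this into Hoeffding at t = l gives l·e²/2 + l²·e²/2. -/
lemma sum_mul_exp_loss_le {p q : PMF ι} (hp : ∀ j, p j ≠ 0) (hq : ∀ j, q j ≠ 0) {e : ℝ}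
    (he : ∀ j, |loss p q j| ≤ e) {l : ℝ} (hl : 0 ≤ l) :
    ∑ j, (p j).toReal * Real.exp (l * loss p q j) ≤ Real.exp (l * (l + 1) * e ^ 2 / 2) := by
  have h1 := sum_mul_exp_le p he (-1)
  have h2 : ∑ j, (p j).toReal * Real.exp (-1 * loss p q j) = 1 := by
    refine Eq.trans ?_ (sum_toReal q)
    refine Finset.sum_congr rfl fun j _ => ?_
    have hpj := toReal_apply_pos (hp j)
    have hqj := toReal_apply_pos (hq j)
    rw [loss, neg_one_mul, Real.exp_neg, Real.exp_log (div_pos hpj hqj)]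
    field_simp
  rw [h2, Real.one_le_exp_iff] at h1
  refine (sum_mul_exp_le p he l).trans (Real.exp_le_exp.mpr ?_)
  nlinarith

lemma expect_exp_loss_le {p q : PMF ι} (hp : ∀ j, p j ≠ 0) (hq : ∀ j, q j ≠ 0) {e : ℝ}
    (he : ∀ j, |loss p q j| ≤ e) {l : ℝ} (hl : 0 ≤ l) :
    expect p (fun j => ENNReal.ofReal (Real.exp (l * loss p q j))) ≤
      ENNReal.ofReal (Real.exp (l * (l + 1) * e ^ 2 / 2)) := by
  refine le_trans (le_of_eq ?_) (ENNReal.ofReal_le_ofReal (sum_mul_exp_loss_le hp hq he hl))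
  rw [expect, tsum_fintype, ENNReal.ofReal_sum_of_nonneg fun j _ => by positivity]
  refine Finset.sum_congr rfl fun j _ => ?_
  rw [ENNReal.ofReal_mul ENNReal.toReal_nonneg, ENNReal.ofReal_toReal (p.apply_ne_top j)]

end Loss

/-! ### Advanced composition -/

section Composition

variable {Ω ι : Type*}

/-- The law after `t` steps of the process that starts in `x₀`, draws in the state `x` an outcome
from `M x`, and updates the state by `u`. -/
noncomputable def chain (M : Ω → PMF ι) (u : Ω → ι → Ω) (x₀ : Ω) : ℕ → PMF Ω
  | 0 => PMF.pure x₀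
  | t + 1 => (chain M u x₀ t).bind fun x => (M x).map (u x)

/-- The joint law of the state and of the accumulated privacy loss with respect to `M'`. -/
noncomputable def lossChain (M M' : Ω → PMF ι) (u : Ω → ι → Ω) (x₀ : Ω) : ℕ → PMF (Ω × ℝ)
  | 0 => PMF.pure (x₀, 0)
  | t + 1 => (lossChain M M' u x₀ t).bind fun w =>
      (M w.1).map fun j => (u w.1 j, w.2 + loss (M w.1) (M' w.1) j)

variable {M M' : Ω → PMF ι} {u : Ω → ι → Ω} {x₀ : Ω}

lemma expect_lossChain_fst (t : ℕ) (f : Ω → ℝ≥0∞) :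
    expect (lossChain M M' u x₀ t) (fun w => f w.1) = expect (chain M u x₀ t) f := by
  induction t generalizing f with
  | zero => simp [lossChain, chain, expect_pure]
  | succ t ih =>
    rw [lossChain, chain, expect_bind, expect_bind, ← ih]
    simp_rw [expect_map]

/-- The losses add up along a path, so exp(-loss) is the likelihood ratio of the whole path under
`M'` against `M`. -/
lemma expect_lossChain_mul_exp_neg (hM : ∀ x j, M x j ≠ 0) (hM' : ∀ x j, M' x j ≠ 0) (t : ℕ)
    (f : Ω → ℝ≥0∞) :
    expect (lossChain M M' u x₀ t) (fun w => f w.1 * ENNReal.ofReal (Real.exp (-w.2))) =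
      expect (chain M' u x₀ t) f := by
  induction t generalizing f with
  | zero => simp [lossChain, chain, expect_pure]
  | succ t ih =>
    rw [lossChain, chain, expect_bind, expect_bind, ← ih]
    congr 1
    funext w
    rw [expect_map, expect_map, ← expect_mul_exp_neg_loss (hM w.1) (hM' w.1), mul_comm,
      ← expect_const_mul]
    congr 1
    funext j
    rw [neg_add, Real.exp_add, ENNReal.ofReal_mul (Real.exp_pos _).le]
    ring

variable [Fintype ι]

/-- The one-step moment bound is uniform in the state, so it multiplies over the steps despite their
dependence. -/
lemma expect_lossChain_exp_le (hM : ∀ x j, M x j ≠ 0) (hM' : ∀ x j, M' x j ≠ 0) {e : ℝ}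
    (he : ∀ x j, |loss (M x) (M' x) j| ≤ e) {l : ℝ} (hl : 0 ≤ l) (t : ℕ) :
    expect (lossChain M M' u x₀ t) (fun w => ENNReal.ofReal (Real.exp (l * w.2))) ≤
      ENNReal.ofReal (Real.exp (t * (l * (l + 1) * e ^ 2 / 2))) := by
  induction t with
  | zero => simp [lossChain, expect_pure]
  | succ t ih =>
    rw [lossChain, expect_bind]
    calc _ ≤ expect (lossChain M M' u x₀ t) (fun w =>
          ENNReal.ofReal (Real.exp (l * (l + 1) * e ^ 2 / 2)) *
            ENNReal.ofReal (Real.exp (l * w.2))) := by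
          refine expect_mono _ fun w => ?_
          rw [expect_map]
          simp only [mul_add, Real.exp_add, ENNReal.ofReal_mul (Real.exp_pos _).le]
          rw [expect_const_mul, mul_comm]
          gcongr
          simpa only [mul_add] using expect_exp_loss_le (hM w.1) (hM' w.1) (he w.1) hl
      _ ≤ ENNReal.ofReal (Real.exp (l * (l + 1) * e ^ 2 / 2)) *
            ENNReal.ofReal (Real.exp (t * (l * (l + 1) * e ^ 2 / 2))) := by
          rw [expect_const_mul]
          gcongr
      _ = _ := by
          rw [← ENNReal.ofReal_mul (Real.exp_pos _).le, ← Real.exp_add]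
          congr 2
          push_cast
          ring

/-- Advanced composition of pure differentially private steps. -/
lemma chain_toOuterMeasure_le (hM : ∀ x j, M x j ≠ 0) (hM' : ∀ x j, M' x j ≠ 0) {e : ℝ}
    (he : ∀ x j, |loss (M x) (M' x) j| ≤ e) {l ε δ : ℝ} (hl : 0 ≤ l) {t : ℕ}
    (hδ : Real.exp (t * (l * (l + 1) * e ^ 2 / 2) - l * ε) ≤ δ) (O : Set Ω) :
    (chain M u x₀ t).toOuterMeasure O ≤
      ENNReal.ofReal (Real.exp ε) * (chain M' u x₀ t).toOuterMeasure O + ENNReal.ofReal δ := by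
  rw [toOuterMeasure_eq_expect, toOuterMeasure_eq_expect, ← expect_lossChain_fst (M' := M'),
    ← expect_lossChain_mul_exp_neg (M := M) hM hM', ← expect_const_mul]
  -- Pointwise bound: where the loss is at most ε, the first summand dominates the indicator; where
  -- it is larger, the Chernoff term exp(l(loss - ε)) is at least one.
  calc _ ≤ expect (lossChain M M' u x₀ t) (fun w => ENNReal.ofReal (Real.exp ε) *
          (O.indicator 1 w.1 * ENNReal.ofReal (Real.exp (-w.2))) +
          ENNReal.ofReal (Real.exp (-(l * ε))) * ENNReal.ofReal (Real.exp (l * w.2))) := by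
        refine expect_mono _ fun w => ?_
        by_cases hw : w.1 ∈ O
        · rw [Set.indicator_of_mem hw, Pi.one_apply, one_mul,
            ← ENNReal.ofReal_mul (Real.exp_pos _).le, ← ENNReal.ofReal_mul (Real.exp_pos _).le,
            ← Real.exp_add, ← Real.exp_add]
          rcases le_total w.2 ε with h | h
          · refine le_add_right ?_
            rw [ENNReal.one_le_ofReal, Real.one_le_exp_iff]
            linarith
          · refine le_add_left ?_
            rw [ENNReal.one_le_ofReal, Real.one_le_exp_iff]
            nlinarith
        · rw [Set.indicator_of_notMem hw]
          exact zero_le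
    _ ≤ _ := by
        rw [expect_add]
        gcongr
        rw [expect_const_mul]
        refine (mul_le_mul_right (expect_lossChain_exp_le hM hM' he hl t) _).trans ?_
        rw [← ENNReal.ofReal_mul (Real.exp_pos _).le, ← Real.exp_add]
        refine ENNReal.ofReal_le_ofReal (le_trans (le_of_eq ?_) hδ)
        congr 1
        ring

end Composition

/-! ### The exponential mechanism -/

section ExpMechanism

variable {ι : Type*} [Fintype ι] [Nonempty ι]

lemma toReal_expMechanism (ε Δ : ℝ) (Q : ι → ℝ) (j : ι) :
    (expMechanism ε Δ Q j).toReal =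
      Real.exp (ε * Q j / (2 * Δ)) / ∑ k, Real.exp (ε * Q k / (2 * Δ)) := by
  rw [expMechanism, PMF.normalize_apply, tsum_fintype,
    ← ENNReal.ofReal_sum_of_nonneg fun _ _ => (Real.exp_pos _).le, ENNReal.toReal_mul,
    ENNReal.toReal_inv, ENNReal.toReal_ofReal (Real.exp_pos _).le,
    ENNReal.toReal_ofReal (Finset.sum_nonneg fun _ _ => (Real.exp_pos _).le)]
  exact (div_eq_mul_inv _ _).symm

lemma sum_exp_pos (f : ι → ℝ) : 0 < ∑ k, Real.exp (f k) :=
  Finset.sum_pos (fun _ _ => Real.exp_pos _) Finset.univ_nonempty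

lemma expMechanism_ne_zero (ε Δ : ℝ) (Q : ι → ℝ) (j : ι) : expMechanism ε Δ Q j ≠ 0 := by
  intro h
  have h2 := toReal_expMechanism ε Δ Q j
  rw [h, ENNReal.toReal_zero] at h2
  have := div_pos (Real.exp_pos (ε * Q j / (2 * Δ))) (sum_exp_pos fun k => ε * Q k / (2 * Δ))
  linarith

/-- The numerator and the normaliser each change by at most a factor exp(ε/2). -/
lemma loss_expMechanism_le {ε Δ : ℝ} (hε : 0 ≤ ε) (hΔ : 0 < Δ) {Q Q' : ι → ℝ}
    (hQ : ∀ j, |Q j - Q' j| ≤ Δ) (j : ι) :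
    loss (expMechanism ε Δ Q) (expMechanism ε Δ Q') j ≤ ε := by
  have hdiff : ∀ j, |ε * Q j / (2 * Δ) - ε * Q' j / (2 * Δ)| ≤ ε / 2 := fun j => by
    have : ε * Q j / (2 * Δ) - ε * Q' j / (2 * Δ) = ε / (2 * Δ) * (Q j - Q' j) := by ring
    rw [this, abs_mul, abs_of_nonneg (by positivity)]
    calc ε / (2 * Δ) * |Q j - Q' j| ≤ ε / (2 * Δ) * Δ := by gcongr; exact hQ j
      _ = ε / 2 := by field_simp
  rw [loss, toReal_expMechanism, toReal_expMechanism]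
  have hZ := sum_exp_pos fun k => ε * Q k / (2 * Δ)
  have hZ' := sum_exp_pos fun k => ε * Q' k / (2 * Δ)
  have hsum : ∑ k, Real.exp (ε * Q' k / (2 * Δ)) ≤
      Real.exp (ε / 2) * ∑ k, Real.exp (ε * Q k / (2 * Δ)) := by
    rw [Finset.mul_sum]
    refine Finset.sum_le_sum fun k _ => ?_
    rw [← Real.exp_add, Real.exp_le_exp]
    linarith [(abs_le.mp (hdiff k)).1]
  have hlog := Real.log_le_log hZ' hsum
  rw [Real.log_mul (Real.exp_pos _).ne' hZ.ne', Real.log_exp] at hlog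
  rw [Real.log_div (div_pos (Real.exp_pos _) hZ).ne' (div_pos (Real.exp_pos _) hZ').ne',
    Real.log_div (Real.exp_pos _).ne' hZ.ne', Real.log_div (Real.exp_pos _).ne' hZ'.ne',
    Real.log_exp, Real.log_exp]
  linarith [(abs_le.mp (hdiff j)).2]

lemma abs_loss_expMechanism_le {ε Δ : ℝ} (hε : 0 ≤ ε) (hΔ : 0 < Δ) {Q Q' : ι → ℝ}
    (hQ : ∀ j, |Q j - Q' j| ≤ Δ) (j : ι) :
    |loss (expMechanism ε Δ Q) (expMechanism ε Δ Q') j| ≤ ε := by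
  have h := loss_expMechanism_le hε hΔ (fun j => (abs_sub_comm _ _).trans_le (hQ j)) j
  rw [loss_comm] at h
  exact abs_le.mpr ⟨by linarith, loss_expMechanism_le hε hΔ hQ j⟩

/-- The exponential mechanism chooses a candidate far from the best one with small probability. -/
lemma expMechanism_toOuterMeasure_le {ε Δ b : ℝ} (hε : 0 < ε) (hΔ : 0 < Δ) (hb : 0 < b)
    (Q : ι → ℝ) (k : ι) :
    (expMechanism ε Δ Q).toOuterMeasure
      {j | Q j < Q k - 2 * Δ / ε * (Real.log (Fintype.card ι) + Real.log (1 / b))} ≤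
      ENNReal.ofReal b := by
  set G := 2 * Δ / ε * (Real.log (Fintype.card ι) + Real.log (1 / b)) with hG
  have hcard : (0 : ℝ) < Fintype.card ι := by exact_mod_cast Fintype.card_pos
  rw [PMF.toOuterMeasure_apply_fintype]
  calc _ ≤ ∑ _j : ι, ENNReal.ofReal (b / Fintype.card ι) := by
        refine Finset.sum_le_sum fun j _ => ?_
        by_cases hj : j ∈ {j | Q j < Q k - G}
        · rw [Set.indicator_of_mem hj,
            ← ENNReal.ofReal_toReal ((expMechanism ε Δ Q).apply_ne_top j)]
          refine ENNReal.ofReal_le_ofReal ?_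
          rw [toReal_expMechanism, div_le_iff₀ (sum_exp_pos fun k => ε * Q k / (2 * Δ))]
          -- The normaliser is at least the weight of k, and a gap of G makes the weight of j at
          -- most b/card times that of k; summing over all candidates gives b.
          have h1 : Real.exp (ε * Q k / (2 * Δ)) ≤ ∑ k, Real.exp (ε * Q k / (2 * Δ)) :=
            Finset.single_le_sum (f := fun k => Real.exp (ε * Q k / (2 * Δ)))
              (fun _ _ => (Real.exp_pos _).le) (Finset.mem_univ k)
          refine le_trans ?_ (mul_le_mul_of_nonneg_left h1 (by positivity))
          rw [← Real.exp_log (show 0 < b / Fintype.card ι by positivity), ← Real.exp_add,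
            Real.exp_le_exp, Real.log_div hb.ne' hcard.ne']
          rw [one_div, Real.log_inv] at hG
          have h2 : ε * (Q k - G) / (2 * Δ) =
              Real.log b - Real.log (Fintype.card ι) + ε * Q k / (2 * Δ) := by
            rw [hG]
            field_simp
            ring
          rw [← h2]
          have hj' : Q j ≤ Q k - G := le_of_lt hj
          gcongr
        · rw [Set.indicator_of_notMem hj]
          exact zero_le
    _ = ENNReal.ofReal b := by
        rw [← ENNReal.ofReal_sum_of_nonneg fun _ _ => by positivity]
        congr 1
        simp only [Finset.sum_const, Finset.card_univ, nsmul_eq_mul]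
        field_simp

end ExpMechanism

/-! ### Calibration of the parameters -/

/-- The parameters are in the ranges in which the algorithm is meaningful. -/
structure Params.Valid (P : Params) (n d : ℕ) : Prop where
  two_le : 2 ≤ n
  H_pos : 0 < P.H d
  opt_pos : 0 < P.opt
  α_pos : 0 < P.α
  α_lt : P.α < 1
  β_pos : 0 < P.β
  β_lt : P.β < 1
  ε_pos : 0 < P.ε
  δ_pos : 0 < P.δ
  δ_lt : P.δ < 1

namespace Params.Valid

variable {P : Params} {n d : ℕ}

lemma log_n_pos (h : P.Valid n d) : 0 < Real.log n :=
  Real.log_pos (by exact_mod_cast h.two_le)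

lemma T_pos (h : P.Valid n d) : 0 < P.T n d := by
  have h1 := h.log_n_pos
  have h2 := h.H_pos
  have h3 := h.opt_pos
  have h4 := h.α_pos
  exact Nat.ceil_pos.mpr (by positivity)

lemma log_inv_δ_pos (h : P.Valid n d) : 0 < Real.log (1 / P.δ) :=
  Real.log_pos (by rw [lt_div_iff₀ h.δ_pos]; linarith [h.δ_lt])

lemma stepε_pos (h : P.Valid n d) : 0 < P.stepε n d := by
  have h1 := h.log_inv_δ_pos
  have h2 : (0 : ℝ) < P.T n d := by exact_mod_cast h.T_pos
  have h3 := h.ε_pos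
  unfold Params.stepε
  positivity

lemma one_le_T (h : P.Valid n d) : (1 : ℝ) ≤ P.T n d := by exact_mod_cast h.T_pos

lemma log_T_div_β_pos (h : P.Valid n d) : 0 < Real.log (P.T n d / P.β) :=
  Real.log_pos (by rw [lt_div_iff₀ h.β_pos]; linarith [h.one_le_T, h.β_lt])

lemma s_pos (h : P.Valid n d) : 0 < P.s n d := by
  have h1 := h.stepε_pos
  have h2 := h.H_pos
  have h3 := h.opt_pos
  have h4 := h.α_pos
  have h5 := h.log_T_div_β_pos
  have h6 := Real.log_natCast_nonneg d
  unfold Params.s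
  positivity

lemma U_pos (h : P.Valid n d) : 0 < P.U n d := one_div_pos.mpr h.s_pos

lemma sensitivity_pos (h : P.Valid n d) : 0 < P.sensitivity n d := by
  have h1 := h.s_pos
  have h2 := h.H_pos
  have h3 := h.opt_pos
  unfold Params.sensitivity
  positivity

lemma η_pos (h : P.Valid n d) : 0 < P.η d := by
  have h2 := h.H_pos
  have h3 := h.opt_pos
  have h4 := h.α_pos
  unfold Params.η
  positivity

/-- The constant 60 in s is chosen here: the error of the exponential mechanism at failure
probability β/T is (2·3/60)α. -/
lemma sensitivity_div_eq (h : P.Valid n d) :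
    2 * P.sensitivity n d / P.stepε n d * (Real.log d + Real.log (P.T n d / P.β)) =
      P.α / 10 := by
  have h1 := h.stepε_pos
  have h2 := h.H_pos
  have h3 := h.opt_pos
  have h4 := h.α_pos
  have h5 : 0 < Real.log d + Real.log (P.T n d / P.β) :=
    add_pos_of_nonneg_of_pos (Real.log_natCast_nonneg d) h.log_T_div_β_pos
  unfold Params.sensitivity Params.s
  field_simp
  norm_num

/-- Ensures that the initial potential, at most log n, is at most an α/2 fraction of ηT. Rounding T
up only helps. -/
lemma η_mul_T_ge (h : P.Valid n d) : 2 * Real.log n / P.α ≤ P.η d * P.T n d := by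
  have h2 := h.H_pos
  have h3 := h.opt_pos
  have h4 := h.α_pos
  have h5 := Nat.le_ceil (20 * P.H d * P.opt * Real.log n / P.α ^ 2)
  calc 2 * Real.log n / P.α
      = P.η d * (20 * P.H d * P.opt * Real.log n / P.α ^ 2) := by
        unfold Params.η
        field_simp
        ring
    _ ≤ _ := mul_le_mul_of_nonneg_left h5 h.η_pos.le

end Params.Valid

/-- All entries of `A` lie in `[0, H]`. -/
def EntriesIn {n d : ℕ} (H : ℝ) (A : Matrix (Fin n) (Fin d) ℝ) : Prop :=
  ∀ i j, 0 ≤ A i j ∧ A i j ≤ H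

/-! ### Privacy of the algorithm -/

section Privacy

variable {P : Params} {n d : ℕ}

lemma abs_score_sub_le (h : P.Valid n d) {A A' : Matrix (Fin n) (Fin d) ℝ}
    (hA : EntriesIn (P.H d) A) (hA' : EntriesIn (P.H d) A') (hN : Neighbor A A')
    (x : Fin d → ℝ) (j : Fin d) : |score P A x j - score P A' x j| ≤ P.sensitivity n d := by
  obtain ⟨i, hi⟩ := hN
  have key := abs_gradSmax_dotProduct_sub_le (n := n) h.U_pos h.H_pos.le (i := i)
    (z := P.η d • A.mulVec x) (z' := P.η d • A'.mulVec x) (a := A.col j) (a' := A'.col j)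
    (fun k hk => by simp [Matrix.mulVec, hi k hk]) (fun k hk => by simp [Matrix.col, hi k hk])
    (fun k => (hA k j).1) (fun k => (hA k j).2) (fun k => (hA' k j).1) (fun k => (hA' k j).2)
  rw [score, score, ← sub_mul, abs_mul, abs_of_pos h.opt_pos, neg_sub_neg, abs_sub_comm]
  calc _ ≤ 3 * P.H d * P.U n d * P.opt := mul_le_mul_of_nonneg_right key h.opt_pos.le
    _ = P.sensitivity n d := by
      unfold Params.sensitivity Params.U
      ring

lemma iterate_eq_chain [NeZero d] (P : Params) (A : Matrix (Fin n) (Fin d) ℝ) (t : ℕ) :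
    iterate P A t =
      chain (fun x => expMechanism (P.stepε n d) (P.sensitivity n d) (score P A x))
        (fun x j => x + Pi.single j P.opt) 0 t := by
  induction t with
  | zero => rfl
  | succ t ih =>
    rw [iterate, chain, ih]
    congr 1
    funext x
    rw [oracle, PMF.map_comp]
    rfl

/-- With L = log(1/δ) one has T·ε'² = ε²/(4L). The moment order l = 3L/ε makes the exponent 9L/8 +
3ε/8 - 3L, which is at most -9L/8 when ε ≤ 2L. -/
lemma exp_composition_le (h : P.Valid n d) (hε : P.ε ≤ 2 * Real.log (1 / P.δ)) :
    Real.exp (P.T n d * (3 * Real.log (1 / P.δ) / P.ε * (3 * Real.log (1 / P.δ) / P.ε + 1) *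
      P.stepε n d ^ 2 / 2) - 3 * Real.log (1 / P.δ) / P.ε * P.ε) ≤ P.δ := by
  have hL := h.log_inv_δ_pos
  have hT : (0 : ℝ) < P.T n d := by exact_mod_cast h.T_pos
  have hε0 := h.ε_pos
  rw [← Real.le_log_iff_exp_le h.δ_pos]
  have hδ : Real.log P.δ = -Real.log (1 / P.δ) := by rw [one_div, Real.log_inv, neg_neg]
  rw [hδ]
  set L := Real.log (1 / P.δ)
  have hstep : P.stepε n d ^ 2 = P.ε ^ 2 / (4 * (P.T n d * L)) := by
    rw [Params.stepε, div_pow, mul_pow, Real.sq_sqrt (by positivity)]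
    ring
  rw [hstep]
  have : (P.T n d : ℝ) * (3 * L / P.ε * (3 * L / P.ε + 1) * (P.ε ^ 2 / (4 * (P.T n d * L))) / 2)
      - 3 * L / P.ε * P.ε = 9 / 8 * L + 3 / 8 * P.ε - 3 * L := by
    field_simp
    ring
  rw [this]
  linarith

lemma algorithm_toOuterMeasure_le [NeZero d] (h : P.Valid n d)
    (hε : P.ε ≤ 2 * Real.log (1 / P.δ)) {A A' : Matrix (Fin n) (Fin d) ℝ}
    (hA : EntriesIn (P.H d) (preprocess P A)) (hA' : EntriesIn (P.H d) (preprocess P A'))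
    (hN : Neighbor (preprocess P A) (preprocess P A')) (O : Set (Fin d → ℝ)) :
    (algorithm P A).toOuterMeasure O ≤
      ENNReal.ofReal (Real.exp P.ε) * (algorithm P A').toOuterMeasure O +
        ENNReal.ofReal P.δ := by
  rw [algorithm, algorithm, PMF.toOuterMeasure_map_apply, PMF.toOuterMeasure_map_apply,
    iterate_eq_chain, iterate_eq_chain]
  refine chain_toOuterMeasure_le (fun _ _ => expMechanism_ne_zero _ _ _ _)
    (fun _ _ => expMechanism_ne_zero _ _ _ _)
    (fun x => abs_loss_expMechanism_le h.stepε_pos.le h.sensitivity_pos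
      (abs_score_sub_le h hA hA' hN x)) ?_ (exp_composition_le h hε) _
  have h1 := h.log_inv_δ_pos
  have h2 := h.ε_pos
  positivity

end Privacy

/-! ### Number of violated constraints and objective value -/

section Accuracy

variable {P : Params} {n d : ℕ}

/-- Test the supremum with the uniform distribution on B: it respects the cap because |B| ≥ 1/U, and
its entropy is nonnegative. -/
lemma le_smax_of_forall_le {U θ : ℝ} (hU : 0 < U) (hn : 1 ≤ n * U) {z : Fin n → ℝ}
    {B : Finset (Fin n)} (hB : 1 / U ≤ B.card) (hz : ∀ i ∈ B, θ ≤ z i) : θ ≤ smax U z := by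
  have hm : (0 : ℝ) < B.card := lt_of_lt_of_le (by positivity) hB
  have hm1 : (1 : ℝ) ≤ B.card := by
    exact_mod_cast Nat.cast_pos.mp hm
  let r : Fin n → ℝ := fun i => if i ∈ B then (B.card : ℝ)⁻¹ else 0
  have hsum : ∀ f : Fin n → ℝ, ∑ i, f i * r i = ∑ i ∈ B, f i * (B.card : ℝ)⁻¹ := fun f => by
    simp [r, mul_ite, Finset.sum_ite_mem]
  have hr : r ∈ cappedSimplex n U := by
    refine ⟨⟨fun i => ?_, ?_⟩, fun i => ?_⟩
    · by_cases hi : i ∈ B <;> simp [r, hi]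
    · have := hsum 1
      simp only [Pi.one_apply, one_mul, Finset.sum_const, nsmul_eq_mul] at this
      rw [this, mul_inv_cancel₀ hm.ne']
    · by_cases hi : i ∈ B
      · simp only [r, hi, if_true]
        rw [inv_le_comm₀ hm hU, ← one_div]
        exact hB
      · simp [r, hi, hU.le]
  have hent : ∑ i, r i * Real.log (r i) ≤ 0 := by
    refine Finset.sum_nonpos fun i _ => ?_
    have h0 : 0 ≤ r i := hr.1.1 i
    have h1 : r i ≤ 1 := by
      by_cases hi : i ∈ B
      · simp only [r, hi, if_true]
        exact inv_le_one_of_one_le₀ hm1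
      · simp [r, hi]
    exact mul_nonpos_of_nonneg_of_nonpos h0 (Real.log_nonpos h0 h1)
  have hdot : θ ≤ z ⬝ᵥ r := by
    rw [dotProduct, hsum]
    calc θ = ∑ _i ∈ B, θ * (B.card : ℝ)⁻¹ := by
          rw [Finset.sum_const, nsmul_eq_mul]
          field_simp
      _ ≤ _ := by
          refine Finset.sum_le_sum fun i hi => ?_
          gcongr
          exact hz i hi
  linarith [le_smax hU hn z hr]

/-- Some column is cheap for the weights `y`, because the optimal solution is feasible. -/
lemma exists_dotProduct_col_mul_le [NeZero d] {A : Matrix (Fin n) (Fin d) ℝ} {y : Fin n → ℝ}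
    (hy : y ∈ stdSimplex ℝ (Fin n)) {x : Fin d → ℝ} (hx : ∀ j, 0 ≤ x j)
    (hAx : ∀ i, A.mulVec x i ≤ 1) : ∃ j, (y ⬝ᵥ A.col j) * ∑ j, x j ≤ 1 := by
  obtain ⟨k, hk⟩ := Finite.exists_min fun j => y ⬝ᵥ A.col j
  refine ⟨k, ?_⟩
  calc (y ⬝ᵥ A.col k) * ∑ j, x j ≤ ∑ j, (y ⬝ᵥ A.col j) * x j := by
        rw [Finset.mul_sum]
        exact Finset.sum_le_sum fun j _ => mul_le_mul_of_nonneg_right (hk j) (hx j)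
    _ = y ⬝ᵥ A.mulVec x := by
        rw [Matrix.dotProduct_mulVec]
        rfl
    _ ≤ ∑ i, y i := by
        refine Finset.sum_le_sum fun i _ => ?_
        nlinarith [hy.1 i, hAx i]
    _ = 1 := hy.2

/-- The step size satisfies η·opt·H = α/10, so `smax_add_le` applies with a = α/10, and the linear
term is the score. -/
lemma smax_update_le (h : P.Valid n d) (hn : 1 ≤ n * P.U n d) {A : Matrix (Fin n) (Fin d) ℝ}
    (hA : EntriesIn (P.H d) A) (x : Fin d → ℝ) (j : Fin d) :
    smax (P.U n d) (P.η d • A.mulVec (x + Pi.single j P.opt)) ≤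
      smax (P.U n d) (P.η d • A.mulVec x) - Real.exp (P.α / 10) * P.η d * score P A x j := by
  have hη := h.η_pos
  have ho := h.opt_pos
  have hα := h.α_pos
  have hH := h.H_pos
  have hz : P.η d • A.mulVec (x + Pi.single j P.opt) =
      P.η d • A.mulVec x + (P.η d * P.opt) • A.col j := by
    rw [Matrix.mulVec_add, Matrix.mulVec_single, smul_add]
    simp [smul_smul]
  have hval : P.η d * P.opt * P.H d = P.α / 10 := by
    unfold Params.η
    field_simp
  have := smax_add_le h.U_pos hn (P.η d • A.mulVec x) ((P.η d * P.opt) • A.col j)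
    (a := P.α / 10) (by positivity)
    (fun i => by
      simp only [Pi.smul_apply, smul_eq_mul, Matrix.col_apply]
      have := (hA i j).1
      positivity)
    (fun i => by
      simp only [Pi.smul_apply, smul_eq_mul, Matrix.col_apply]
      rw [← hval]
      have := (hA i j).2
      gcongr)
  rw [hz]
  refine this.trans (le_of_eq ?_)
  rw [dotProduct_smul, score, smul_eq_mul]
  ring

/-- The iterate `x_t` is nonnegative and its potential is as small as the analysis predicts. -/
def PotentialBound (P : Params) {n d : ℕ} (A : Matrix (Fin n) (Fin d) ℝ) (t : ℕ)
    (x : Fin d → ℝ) : Prop :=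
  (∀ j, 0 ≤ x j) ∧ smax (P.U n d) (P.η d • A.mulVec x) ≤
    Real.log n + t * (Real.exp (P.α / 10) * P.η d * (1 + P.α / 10))

/-- Union bound over the steps: from a good state, one draw spoils the bound with probability at
most β/T. -/
lemma toOuterMeasure_iterate_not_potentialBound_le [NeZero d] (h : P.Valid n d)
    (hn : 1 ≤ n * P.U n d) {A : Matrix (Fin n) (Fin d) ℝ} (hA : EntriesIn (P.H d) A)
    {x : Fin d → ℝ} (hx : ∀ j, 0 ≤ x j) (hAx : ∀ i, A.mulVec x i ≤ 1) (hsum : ∑ j, x j = P.opt)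
    (t : ℕ) :
    (iterate P A t).toOuterMeasure {w | ¬ PotentialBound P A t w} ≤
      ENNReal.ofReal (t * (P.β / P.T n d)) := by
  have hβ := h.β_pos
  have hT : (0 : ℝ) < P.T n d := by exact_mod_cast h.T_pos
  induction t with
  | zero =>
    have : PotentialBound P A 0 0 := by
      refine ⟨fun _ => le_rfl, ?_⟩
      simpa using smax_zero_le h.U_pos hn
    rw [iterate, PMF.toOuterMeasure_pure_apply]
    simp [this]
  | succ t ih =>
    rw [iterate_eq_chain] at ih ⊢
    rw [toOuterMeasure_eq_expect] at ih ⊢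
    rw [chain, expect_bind]
    calc _ ≤ expect (chain (fun x => expMechanism (P.stepε n d) (P.sensitivity n d)
            (score P A x)) (fun x j => x + Pi.single j P.opt) 0 t)
            (fun w => {w | ¬ PotentialBound P A t w}.indicator 1 w +
              ENNReal.ofReal (P.β / P.T n d)) := by
          refine expect_mono _ fun w => ?_
          rw [← toOuterMeasure_eq_expect, PMF.toOuterMeasure_map_apply]
          by_cases hw : PotentialBound P A t w
          · refine le_add_left ?_
            obtain ⟨k, hk⟩ := exists_dotProduct_col_mul_le (A := A)
              (gradSmax_mem_cappedSimplex h.U_pos hn (P.η d • A.mulVec w)).1 hx hAx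
            rw [hsum] at hk
            refine le_trans (MeasureTheory.measure_mono ?_)
              (expMechanism_toOuterMeasure_le h.stepε_pos h.sensitivity_pos
                (div_pos hβ hT) (score P A w) k)
            intro j hj
            by_contra hcon
            refine hj ⟨fun i => add_nonneg (hw.1 i) ?_, ?_⟩
            · rw [Pi.single_apply]
              split_ifs
              exacts [h.opt_pos.le, le_rfl]
            -- The column k has score at least -1, and the draw loses at most α/10 against it.
            · rw [Set.mem_ofPred_eq, not_lt, Fintype.card_fin, one_div_div,
                h.sensitivity_div_eq] at hcon
              have hscore : -score P A w j ≤ 1 + P.α / 10 := by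
                have : score P A w k =
                  -(gradSmax (P.U n d) (P.η d • A.mulVec w) ⬝ᵥ A.col k * P.opt) := by
                  rw [score, neg_mul]
                linarith
              have hη := h.η_pos
              have h1 := smax_update_le h hn hA w j
              have h2 : Real.exp (P.α / 10) * P.η d * -score P A w j ≤
                  Real.exp (P.α / 10) * P.η d * (1 + P.α / 10) := by gcongr
              have h3 := hw.2
              push_cast
              linarith
          · refine le_add_right ?_
            rw [Set.indicator_of_mem (show w ∈ {w | ¬ PotentialBound P A t w} from hw)]
            rw [toOuterMeasure_eq_expect]
            refine (expect_mono _ fun a => ?_).trans_eq (expect_const _ 1)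
            exact Set.indicator_le_self' (fun _ _ => zero_le) a
      _ ≤ ENNReal.ofReal (t * (P.β / P.T n d)) + ENNReal.ofReal (P.β / P.T n d) := by
          rw [expect_add, expect_const]
          gcongr
      _ = _ := by
          rw [← ENNReal.ofReal_add (by positivity) (by positivity)]
          congr 1
          push_cast
          ring

lemma numViolated_le_card (A : Matrix (Fin n) (Fin d) ℝ) (α : ℝ) (x : Fin d → ℝ) :
    numViolated A α x ≤ n := by
  have := Set.ncard_le_ncard (Set.subset_univ {i | 1 + α < A.mulVec x i})
  simpa [numViolated] using this

/-- More than s violations would give ηT(1+α) ≤ log n + ηT(1+3α/10), whose right side is at most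
ηT(1+4α/5). -/
lemma numViolated_le_of_potentialBound (h : P.Valid n d) (hn : 1 ≤ n * P.U n d)
    {A : Matrix (Fin n) (Fin d) ℝ} {x : Fin d → ℝ} (hx : PotentialBound P A (P.T n d) x) :
    (numViolated A P.α ((P.T n d : ℝ)⁻¹ • x) : ℝ) ≤ P.s n d := by
  classical
  by_contra! hcon
  have hT : (0 : ℝ) < P.T n d := by exact_mod_cast h.T_pos
  have hη := h.η_pos
  have hα := h.α_pos
  have hα1 := h.α_lt
  let B : Finset (Fin n) :=
    Finset.univ.filter fun i => 1 + P.α < A.mulVec ((P.T n d : ℝ)⁻¹ • x) i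
  have hB : (numViolated A P.α ((P.T n d : ℝ)⁻¹ • x)) = B.card := by
    rw [numViolated, ← Set.ncard_coe_finset]
    congr 1
    ext i
    simp [B]
  rw [hB] at hcon
  have hlow := le_smax_of_forall_le (θ := P.η d * P.T n d * (1 + P.α)) h.U_pos hn
    (z := P.η d • A.mulVec x) (B := B) (by rw [Params.U, one_div_one_div]; exact hcon.le)
    (fun i hi => by
      have hi' := (Finset.mem_filter.mp hi).2
      rw [Matrix.mulVec_smul, Pi.smul_apply, smul_eq_mul, ← div_eq_inv_mul,
        lt_div_iff₀ hT] at hi'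
      rw [Pi.smul_apply, smul_eq_mul, mul_assoc, mul_comm (P.T n d : ℝ)]
      gcongr)
  have hlog : Real.log n ≤ P.η d * P.T n d * (P.α / 2) := by
    have := h.η_mul_T_ge
    rw [div_le_iff₀ hα] at this
    linarith
  have hexp : Real.exp (P.α / 10) * (1 + P.α / 10) ≤ 1 + 3 / 10 * P.α := by
    have h1 := (abs_le.mp (Real.abs_exp_sub_one_sub_id_le
      (show |P.α / 10| ≤ 1 by rw [abs_of_pos (by positivity)]; linarith))).2
    have h2 : Real.exp (P.α / 10) ≤ 1 + P.α / 10 + (P.α / 10) ^ 2 := by linarith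
    have h3 : P.α ^ 2 ≤ P.α := by nlinarith
    have h4 : P.α ^ 3 ≤ P.α := by nlinarith
    calc _ ≤ (1 + P.α / 10 + (P.α / 10) ^ 2) * (1 + P.α / 10) := by gcongr
      _ ≤ _ := by nlinarith
  have hup := hx.2
  have hηT : 0 < P.η d * P.T n d := by positivity
  have h5 : (P.T n d : ℝ) * (Real.exp (P.α / 10) * P.η d * (1 + P.α / 10)) ≤
      P.η d * P.T n d * (1 + 3 / 10 * P.α) := by
    calc _ = P.η d * P.T n d * (Real.exp (P.α / 10) * (1 + P.α / 10)) := by ring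
      _ ≤ _ := by gcongr
  nlinarith

/-- A constraint that the post-processed solution violates for the original matrix is also violated
by the unprocessed solution for the pre-processed matrix. -/
lemma numViolated_postprocess_le (h : P.Valid n d) {A : Matrix (Fin n) (Fin d) ℝ}
    (hA : ∀ i j, 0 ≤ A i j) {x : Fin d → ℝ} (hx : ∀ j, 0 ≤ x j) :
    numViolated A P.α (postprocess P x) ≤ numViolated (preprocess P A) P.α x := by
  by_cases hp : P.processing
  · refine Set.ncard_le_ncard (fun i hi => ?_) (Set.toFinite _)
    rw [Set.mem_ofPred_eq] at hi ⊢
    simp only [preprocess, postprocess, hp, if_true, Matrix.mulVec, dotProduct,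
      Matrix.map_apply] at hi ⊢
    have hH := h.H_pos
    have hnn : ∀ j, 0 ≤ min (A i j) (P.H d) * x j := fun j =>
      mul_nonneg (le_min (hA i j) hH.le) (hx j)
    -- One clipped entry facing a surviving coordinate already contributes H·(2/H) = 2 > 1 + α.
    -- Without such a pair, every surviving term has an unclipped entry.
    by_cases hbig : ∃ j, P.H d < A i j ∧ 2 / P.H d < x j
    · obtain ⟨j, hj, hxj⟩ := hbig
      have h1 := Finset.single_le_sum (f := fun j => min (A i j) (P.H d) * x j)
        (fun j _ => hnn j) (Finset.mem_univ j)
      rw [min_eq_right hj.le] at h1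
      rw [div_lt_iff₀ hH] at hxj
      linarith [h.α_lt]
    · push Not at hbig
      refine hi.trans_le (Finset.sum_le_sum fun j _ => ?_)
      split_ifs with hj
      · simpa using hnn j
      · have : A i j ≤ P.H d := by
          by_contra! hlt
          exact hj (hbig j hlt)
        rw [min_eq_left this]
  · simp [preprocess, postprocess, hp]

lemma mulVec_preprocess_le {A : Matrix (Fin n) (Fin d) ℝ} {x : Fin d → ℝ} (hx : ∀ j, 0 ≤ x j)
    (i : Fin n) : (preprocess P A).mulVec x i ≤ A.mulVec x i := by
  by_cases hp : P.processing
  · simp only [preprocess, hp, if_true, Matrix.mulVec, dotProduct, Matrix.map_apply]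
    exact Finset.sum_le_sum fun j _ => mul_le_mul_of_nonneg_right (min_le_left _ _) (hx j)
  · simp [preprocess, hp]

lemma le_toOuterMeasure_numViolated_le [NeZero d] (h : P.Valid n d)
    {A : Matrix (Fin n) (Fin d) ℝ} (hA : ∀ i j, 0 ≤ A i j)
    (hpre : EntriesIn (P.H d) (preprocess P A)) (hopt : IsOpt A P.opt) :
    ENNReal.ofReal (1 - P.β) ≤
      (algorithm P A).toOuterMeasure {x | (numViolated A P.α x : ℝ) ≤ P.s n d} := by
  have htotal : ∀ {α : Type} (p : PMF α), p.toOuterMeasure Set.univ = 1 := fun p => by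
    rw [PMF.toOuterMeasure_apply]
    simp
  have hs := h.s_pos
  -- If nU < 1, then n < s and the event is everything.
  rcases lt_or_ge (n * P.U n d) 1 with hn | hn
  · have : {x | (numViolated A P.α x : ℝ) ≤ P.s n d} = Set.univ := by
      refine Set.eq_univ_of_forall fun x => ?_
      rw [Params.U, mul_one_div, div_lt_one hs] at hn
      exact le_trans (by exact_mod_cast numViolated_le_card A P.α x) hn.le
    rw [this, htotal]
    exact ENNReal.ofReal_le_one.mpr (by linarith [h.β_pos])
  obtain ⟨x, ⟨hx, hAx⟩, hsum⟩ := hopt.1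
  have hT : (0 : ℝ) < P.T n d := by exact_mod_cast h.T_pos
  have hbad := toOuterMeasure_iterate_not_potentialBound_le h hn hpre hx
    (fun i => (mulVec_preprocess_le hx i).trans (hAx i)) hsum (P.T n d)
  rw [mul_div_cancel₀ _ hT.ne'] at hbad
  rw [algorithm, PMF.toOuterMeasure_map_apply]
  set p := iterate P (preprocess P A) (P.T n d)
  have hcover := MeasureTheory.measure_union_le (μ := p.toOuterMeasure)
    {w | PotentialBound P (preprocess P A) (P.T n d) w}
    {w | ¬ PotentialBound P (preprocess P A) (P.T n d) w}
  have huniv : {w | PotentialBound P (preprocess P A) (P.T n d) w} ∪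
      {w | ¬ PotentialBound P (preprocess P A) (P.T n d) w} = Set.univ := by
    ext w
    simp [em]
  rw [huniv, htotal] at hcover
  have hgood : p.toOuterMeasure {w | PotentialBound P (preprocess P A) (P.T n d) w} ≤
      p.toOuterMeasure ((fun x => postprocess P ((P.T n d : ℝ)⁻¹ • x)) ⁻¹'
        {x | (numViolated A P.α x : ℝ) ≤ P.s n d}) := by
    refine MeasureTheory.measure_mono fun w hw => ?_
    have h1 := numViolated_postprocess_le h hA (x := (P.T n d : ℝ)⁻¹ • w)
      fun j => mul_nonneg (inv_nonneg.mpr hT.le) (hw.1 j)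
    exact le_trans (by exact_mod_cast h1) (numViolated_le_of_potentialBound h hn hw)
  refine le_trans ?_ hgood
  rw [ENNReal.ofReal_sub _ h.β_pos.le, ENNReal.ofReal_one, tsub_le_iff_right]
  exact hcover.trans (add_le_add le_rfl hbad)

lemma nonneg_and_sum_of_mem_support_iterate [NeZero d] (hopt : 0 ≤ P.opt)
    {A : Matrix (Fin n) (Fin d) ℝ} {t : ℕ} {x : Fin d → ℝ} (hx : x ∈ (iterate P A t).support) :
    (∀ j, 0 ≤ x j) ∧ ∑ j, x j = t * P.opt := by
  induction t generalizing x with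
  | zero =>
    rw [iterate, PMF.mem_support_pure_iff] at hx
    simp [hx]
  | succ t ih =>
    rw [iterate_eq_chain, chain, PMF.mem_support_bind_iff] at hx
    obtain ⟨w, hw, hx⟩ := hx
    rw [← iterate_eq_chain] at hw
    rw [PMF.mem_support_map_iff] at hx
    obtain ⟨j, -, rfl⟩ := hx
    obtain ⟨h0, h1⟩ := ih hw
    refine ⟨fun i => add_nonneg (h0 i) ?_, ?_⟩
    · rw [Pi.single_apply]
      split_ifs
      exacts [hopt, le_rfl]
    · simp only [Pi.add_apply, Finset.sum_add_distrib, h1, Finset.sum_pi_single',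
        Finset.mem_univ, if_true]
      simp [add_mul]

/-- Each coordinate loses at most 2/H, and d·2/H = α·opt by the choice of H. -/
lemma sum_postprocess_ge (h : P.Valid n d) (x : Fin d → ℝ) :
    ∑ j, x j - P.α * P.opt ≤ ∑ j, postprocess P x j := by
  have hα := h.α_pos
  have ho := h.opt_pos
  have hH := h.H_pos
  by_cases hp : P.processing
  · have hd : d * (2 / P.H d) = P.α * P.opt := by
      have hHd : P.H d = 2 * d / (P.α * P.opt) := by simp [Params.H, hp]
      have hd0 : (d : ℝ) ≠ 0 := by
        rintro h0
        rw [hHd, h0] at hH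
        simp at hH
      rw [hHd]
      field_simp
    have : ∑ j, (x j - 2 / P.H d) ≤ ∑ j, postprocess P x j := by
      refine Finset.sum_le_sum fun j _ => ?_
      simp only [postprocess, hp, if_true]
      have : 0 < 2 / P.H d := by positivity
      split_ifs <;> linarith
    rw [Finset.sum_sub_distrib, Finset.sum_const, Finset.card_univ, Fintype.card_fin,
      nsmul_eq_mul, hd] at this
    exact this
  · simp only [postprocess, hp, Bool.false_eq_true, if_false]
    have : 0 < P.α * P.opt := by positivity
    linarith

lemma postprocess_nonneg {x : Fin d → ℝ} (hx : ∀ j, 0 ≤ x j) (j : Fin d) :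
    0 ≤ postprocess P x j := by
  unfold postprocess
  split_ifs
  · dsimp only
    split_ifs
    exacts [le_rfl, hx j]
  · exact hx j

lemma nonneg_and_sum_of_mem_support_algorithm [NeZero d] (h : P.Valid n d)
    {A : Matrix (Fin n) (Fin d) ℝ} {x : Fin d → ℝ} (hx : x ∈ (algorithm P A).support) :
    (∀ j, 0 ≤ x j) ∧ (1 - P.α) * P.opt ≤ ∑ j, x j := by
  rw [algorithm, PMF.mem_support_map_iff] at hx
  obtain ⟨w, hw, rfl⟩ := hx
  obtain ⟨h0, h1⟩ := nonneg_and_sum_of_mem_support_iterate h.opt_pos.le hw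
  have hT : (0 : ℝ) < P.T n d := by exact_mod_cast h.T_pos
  refine ⟨postprocess_nonneg fun j => mul_nonneg (inv_nonneg.mpr hT.le) (h0 j), ?_⟩
  refine le_trans (le_of_eq ?_) (sum_postprocess_ge h _)
  simp only [Pi.smul_apply, smul_eq_mul, ← Finset.mul_sum, h1]
  field_simp

end Accuracy

/-! ### Consequences of the existence of an optimum -/

section Optimum

variable {n d : ℕ} {A : Matrix (Fin n) (Fin d) ℝ}

lemma le_maxEntry (A : Matrix (Fin n) (Fin d) ℝ) (i : Fin n) (j : Fin d) : A i j ≤ maxEntry A :=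
  le_ciSup (f := fun p : Fin n × Fin d => A p.1 p.2) (Set.finite_range _).bddAbove (i, j)

lemma IsOpt.single_le {v : ℝ} (h : IsOpt A v) {j : Fin d} {a : ℝ} (ha : 0 ≤ a)
    (hA : ∀ i, A i j * a ≤ 1) : a ≤ v := by
  refine h.2 ⟨Pi.single j a, ⟨fun k => ?_, fun i => ?_⟩, ?_⟩
  · rw [Pi.single_apply]
    split_ifs
    exacts [ha, le_rfl]
  · simpa [mul_comm] using hA i
  · simp

lemma IsOpt.maxEntry_pos [NeZero d] {v : ℝ} (h : IsOpt A v) : 0 < maxEntry A := by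
  by_contra! hcon
  have hv : 0 ≤ v := by
    obtain ⟨x, hx, rfl⟩ := h.1
    exact Finset.sum_nonneg fun j _ => hx.1 j
  -- Without a positive entry the whole axis is feasible, contradicting optimality of v.
  have := h.single_le (j := 0) (a := v + 1) (by linarith) fun i => by
    nlinarith [le_maxEntry A i 0]
  linarith

/-- The point 1/A_max on a coordinate axis is feasible. -/
lemma IsOpt.one_le_maxEntry_mul [NeZero d] {v : ℝ} (h : IsOpt A v) : 1 ≤ maxEntry A * v := by
  have hM := h.maxEntry_pos
  have := h.single_le (j := 0) (a := (maxEntry A)⁻¹) (by positivity) fun i => by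
    rw [← div_eq_mul_inv, div_le_one hM]
    exact le_maxEntry A i 0
  rwa [inv_le_iff_one_le_mul₀' hM] at this

lemma IsOpt.pos [NeZero d] {v : ℝ} (h : IsOpt A v) : 0 < v :=
  pos_of_mul_pos_right (lt_of_lt_of_le one_pos h.one_le_maxEntry_mul) h.maxEntry_pos.le

end Optimum

/-! ### Explicit estimates of s -/

section Bounds

variable {P : Params} {n d : ℕ}

lemma half_le_log {x : ℝ} (hx : 2 ≤ x) : 1 / 2 ≤ Real.log x := by
  have h1 := Real.log_le_log two_pos hx
  linarith [Real.log_two_gt_d9]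

namespace Params.Valid

lemma half_le_log_n (h : P.Valid n d) : 1 / 2 ≤ Real.log n :=
  half_le_log (by exact_mod_cast h.two_le)

/-- The rounding error 1 is absorbed by 5·H·opt·log n/α², since log n ≥ 1/2. -/
lemma T_le (h : P.Valid n d) (hG : 1 ≤ P.H d * P.opt) :
    (P.T n d : ℝ) ≤ 25 * (P.H d * P.opt) * Real.log n / P.α ^ 2 := by
  have hα := h.α_pos
  have hα1 := h.α_lt
  have hlog := h.half_le_log_n
  have h1 : (P.T n d : ℝ) < 20 * P.H d * P.opt * Real.log n / P.α ^ 2 + 1 := by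
    refine Nat.ceil_lt_add_one ?_
    have := h.H_pos
    have := h.opt_pos
    positivity
  have h2 : 1 ≤ 5 * (P.H d * P.opt) * Real.log n / P.α ^ 2 := by
    rw [le_div_iff₀ (by positivity)]
    nlinarith [mul_nonneg (sub_nonneg.mpr hG) (sub_nonneg.mpr hlog)]
  have h3 : 25 * (P.H d * P.opt) * Real.log n / P.α ^ 2 =
      20 * P.H d * P.opt * Real.log n / P.α ^ 2 +
        5 * (P.H d * P.opt) * Real.log n / P.α ^ 2 := by ring
  linarith

lemma s_le (h : P.Valid n d) (hG : 1 ≤ P.H d * P.opt) :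
    P.s n d ≤ 600 * ((P.H d * P.opt) ^ (3 / 2 : ℝ) *
      (Real.log d + Real.log (P.T n d / P.β)) *
      √(Real.log n * Real.log (1 / P.δ)) / (P.α ^ 2 * P.ε)) := by
  have hα := h.α_pos
  have hε := h.ε_pos
  have hL := h.log_inv_δ_pos
  have hT := h.T_le hG
  have hT0 : (0 : ℝ) < P.T n d := by exact_mod_cast h.T_pos
  have hlog := h.log_n_pos
  have hV : 0 < Real.log d + Real.log (P.T n d / P.β) :=
    add_pos_of_nonneg_of_pos (Real.log_natCast_nonneg d) h.log_T_div_β_pos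
  have hs : P.s n d = 60 * P.H d * P.opt * (Real.log d + Real.log (P.T n d / P.β)) *
      (2 * √(P.T n d * Real.log (1 / P.δ))) / (P.α * P.ε) := by
    have : 0 < √(P.T n d * Real.log (1 / P.δ)) := Real.sqrt_pos.mpr (by positivity)
    rw [Params.s, Params.stepε]
    field_simp
  rw [hs]
  set L := Real.log (1 / P.δ)
  set V := Real.log d + Real.log (P.T n d / P.β)
  have e1 : 60 * P.H d * P.opt = 60 * (P.H d * P.opt) := by ring
  rw [e1]
  set G := P.H d * P.opt
  have hG0 : 0 < G := by linarith
  have hsqrt : √(P.T n d * L) ≤ 5 * √G * √(Real.log n * L) / P.α := by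
    refine Real.sqrt_le_iff.mpr ⟨by positivity, ?_⟩
    rw [div_pow, mul_pow, mul_pow, Real.sq_sqrt hG0.le, Real.sq_sqrt (by positivity)]
    calc P.T n d * L ≤ 25 * G * Real.log n / P.α ^ 2 * L := by gcongr
      _ = _ := by ring
  have hpow : G ^ (3 / 2 : ℝ) = G * √G := by
    rw [Real.sqrt_eq_rpow, ← Real.rpow_one_add' hG0.le (by norm_num)]
    norm_num
  rw [hpow]
  calc 60 * G * V * (2 * √(P.T n d * L)) / (P.α * P.ε)
      ≤ 60 * G * V * (2 * (5 * √G * √(Real.log n * L) / P.α)) / (P.α * P.ε) := by gcongr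
    _ = _ := by
      field_simp
      ring

lemma le_n_div (h : P.Valid n d) : (n : ℝ) ≤ n / (P.α * P.β) := by
  have h1 := mul_pos h.α_pos h.β_pos
  rw [le_div_iff₀ h1]
  have : P.α * P.β ≤ 1 := by nlinarith [h.α_pos, h.β_pos, h.α_lt, h.β_lt]
  nlinarith [Nat.cast_nonneg (α := ℝ) n]

lemma half_le_log_n_div (h : P.Valid n d) : 1 / 2 ≤ Real.log (n / (P.α * P.β)) :=
  half_le_log (le_trans (by exact_mod_cast h.two_le) h.le_n_div)

lemma log_T_div_β_le (h : P.Valid n d) (hG : 1 ≤ P.H d * P.opt) :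
    Real.log (P.T n d / P.β) ≤
      9 * Real.log (n / (P.α * P.β)) + Real.log (P.H d * P.opt) := by
  have hα := h.α_pos
  have hβ := h.β_pos
  have hG0 : 0 < P.H d * P.opt := by linarith
  have hn : (2 : ℝ) ≤ n := by exact_mod_cast h.two_le
  have hT0 : (0 : ℝ) < P.T n d := by exact_mod_cast h.T_pos
  have hw := h.le_n_div
  set w := (n : ℝ) / (P.α * P.β) with hwdef
  have hw2 : 2 ≤ w := hn.trans hw
  have hw0 : 0 < w := by linarith
  -- The exponent is 9 = 7 + 2: w² absorbs log n/(α²β), and w⁷ ≥ 2⁷ absorbs 25.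
  have h1 : P.T n d / P.β ≤ w ^ 9 * (P.H d * P.opt) := by
    calc P.T n d / P.β ≤ 25 * (P.H d * P.opt) * Real.log n / P.α ^ 2 / P.β := by
          gcongr
          exact h.T_le hG
      _ ≤ 25 * (P.H d * P.opt) * w ^ 2 := by
          rw [div_div, mul_div_assoc]
          have : Real.log n / (P.α ^ 2 * P.β) ≤ w ^ 2 := by
            rw [hwdef, div_pow, mul_pow]
            refine div_le_div₀ (by positivity) ?_ (by positivity) ?_
            · have := Real.log_le_sub_one_of_pos (show (0 : ℝ) < n by linarith)
              nlinarith
            · have : P.β ^ 2 ≤ P.β := by nlinarith [h.β_lt]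
              gcongr
          gcongr
      _ ≤ w ^ 7 * (P.H d * P.opt) * w ^ 2 := by
          have : (25 : ℝ) ≤ w ^ 7 := le_trans (by norm_num) (pow_le_pow_left₀ two_pos.le hw2 7)
          gcongr
      _ = _ := by ring
  have h2 := Real.log_le_log (by positivity) h1
  rw [Real.log_mul (by positivity) hG0.ne', Real.log_pow] at h2
  exact_mod_cast h2

end Params.Valid

/-- With processing, the bound of the theorem dominates `s`. -/
lemma s_le_of_processing (h : P.Valid n d) [NeZero d] (hp : P.processing = true) :
    P.s n d ≤ 36000 * ((d : ℝ) ^ (3 / 2 : ℝ) *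
      (Real.log d + Real.log (n / (P.α * P.β))) *
      √(Real.log n * Real.log (1 / P.δ)) / (P.α ^ (7 / 2 : ℝ) * P.ε)) := by
  have hα := h.α_pos
  have hε := h.ε_pos
  have ho := h.opt_pos
  have hd : (1 : ℝ) ≤ d := by exact_mod_cast NeZero.one_le
  have hd0 : (0 : ℝ) < d := by linarith
  have hG : P.H d * P.opt = 2 * d / P.α := by
    simp only [Params.H, hp, if_true]
    field_simp
  have hG1 : 1 ≤ P.H d * P.opt := by
    rw [hG, le_div_iff₀ hα]
    linarith [h.α_lt]
  have hW := h.half_le_log_n_div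
  have hlogd := Real.log_natCast_nonneg d
  have hV : Real.log d + Real.log (P.T n d / P.β) ≤
      15 * (Real.log d + Real.log (n / (P.α * P.β))) := by
    have h1 := h.log_T_div_β_le hG1
    have h2 : Real.log (P.H d * P.opt) ≤ Real.log d + 2 * Real.log (n / (P.α * P.β)) := by
      rw [hG]
      have h3 : 2 * d / P.α ≤ d * (n / (P.α * P.β)) := by
        rw [mul_div_assoc', div_le_div_iff₀ hα (mul_pos hα h.β_pos)]
        have hn : (2 : ℝ) ≤ n := by exact_mod_cast h.two_le
        have h4 : 2 * P.β ≤ n := by linarith [h.β_lt]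
        calc 2 * d * (P.α * P.β) = d * P.α * (2 * P.β) := by ring
          _ ≤ d * P.α * n := by gcongr
          _ = _ := by ring
      have h5 := Real.log_le_log (by positivity) h3
      rw [Real.log_mul hd0.ne' (by
        have := h.le_n_div
        have hn : (2 : ℝ) ≤ n := by exact_mod_cast h.two_le
        linarith)] at h5
      linarith
    linarith
  have hpow : (P.H d * P.opt) ^ (3 / 2 : ℝ) ≤ 4 * ((d : ℝ) ^ (3 / 2 : ℝ) / P.α ^ (3 / 2 : ℝ)) := by
    rw [hG, Real.div_rpow (by positivity) hα.le, Real.mul_rpow (by norm_num) hd0.le,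
      mul_div_assoc]
    have : (2 : ℝ) ^ (3 / 2 : ℝ) ≤ 4 := by
      calc (2 : ℝ) ^ (3 / 2 : ℝ) ≤ 2 ^ (2 : ℝ) :=
            Real.rpow_le_rpow_of_exponent_le (by norm_num) (by norm_num)
        _ = 4 := by norm_num
    gcongr
  have hα7 : P.α ^ (7 / 2 : ℝ) = P.α ^ (3 / 2 : ℝ) * P.α ^ 2 := by
    rw [← Real.rpow_natCast, ← Real.rpow_add hα]
    norm_num
  have hV0 : 0 ≤ Real.log d + Real.log (P.T n d / P.β) :=
    add_nonneg hlogd h.log_T_div_β_pos.le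
  refine (h.s_le hG1).trans ?_
  rw [hα7]
  -- 36000 = 600·4·15, from `s_le`, `hpow` and `hV`.
  calc _ ≤ 600 * (4 * ((d : ℝ) ^ (3 / 2 : ℝ) / P.α ^ (3 / 2 : ℝ)) *
        (15 * (Real.log d + Real.log (n / (P.α * P.β)))) *
        √(Real.log n * Real.log (1 / P.δ)) / (P.α ^ 2 * P.ε)) := by gcongr
    _ = _ := by
      have : 0 < P.α ^ (3 / 2 : ℝ) := by positivity
      field_simp
      ring

/-- Without processing, the bound of the theorem dominates `s` or the number of constraints. -/
lemma le_of_le_s_of_le_card (h : P.Valid n d) {E K m v : ℝ} (hE : 1 ≤ E) (hK : 1 ≤ K)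
    (hεE : P.ε ≤ E) (hεδ : P.ε ≤ 2 * Real.log (1 / P.δ)) (hm : 1 ≤ m)
    (hmG : m ≤ P.H d * P.opt) (hGm : P.H d * P.opt ≤ K * m) (hvs : v ≤ P.s n d) (hvn : v ≤ n) :
    v ≤ (4 * E + 600 * K ^ 2 * (10 + 2 * K)) * (m ^ (3 / 2 : ℝ) *
      (Real.log d + Real.log (n / (P.α * P.β))) *
      √(Real.log n * Real.log (1 / P.δ)) / (P.α ^ 2 * P.ε)) := by
  have hα := h.α_pos
  have hε := h.ε_pos
  have hL := h.log_inv_δ_pos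
  have hlogn := h.half_le_log_n
  have hW := h.half_le_log_n_div
  have hlogd := Real.log_natCast_nonneg d
  have hm0 : 0 < m := by linarith
  have hV0 : 0 ≤ Real.log d + Real.log (P.T n d / P.β) :=
    add_nonneg hlogd h.log_T_div_β_pos.le
  have hX : 0 ≤ m ^ (3 / 2 : ℝ) * (Real.log d + Real.log (n / (P.α * P.β))) *
      √(Real.log n * Real.log (1 / P.δ)) / (P.α ^ 2 * P.ε) := by
    have : 0 ≤ Real.log d + Real.log (n / (P.α * P.β)) := by linarith
    positivity
  -- For m ≤ n, log(H·opt) is absorbed by log(n/(αβ)) and the estimate of s suffices. For m ≥ n, use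
  -- v ≤ n ≤ m^(3/2); there ε ≤ E keeps the remaining factors bounded below.
  rcases le_total m n with hmn | hmn
  · have hG1 : 1 ≤ P.H d * P.opt := hm.trans hmG
    have hn0 : (0 : ℝ) < n := by linarith
    have hK0 : 0 < K := by linarith
    have hlogG : Real.log (P.H d * P.opt) ≤ 2 * K * Real.log (n / (P.α * P.β)) +
        Real.log (n / (P.α * P.β)) := by
      have h1 : Real.log (P.H d * P.opt) ≤ Real.log (K * (n / (P.α * P.β))) := by
        refine Real.log_le_log (by linarith) (hGm.trans ?_)
        have := hmn.trans h.le_n_div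
        gcongr
      rw [Real.log_mul hK0.ne' (by linarith [h.le_n_div])] at h1
      have h2 := Real.log_le_sub_one_of_pos hK0
      nlinarith
    have hV : Real.log d + Real.log (P.T n d / P.β) ≤
        (10 + 2 * K) * (Real.log d + Real.log (n / (P.α * P.β))) := by
      have h1 := h.log_T_div_β_le hG1
      nlinarith
    have hpow : (P.H d * P.opt) ^ (3 / 2 : ℝ) ≤ K ^ 2 * m ^ (3 / 2 : ℝ) := by
      calc _ ≤ (K * m) ^ (3 / 2 : ℝ) := by gcongr
        _ = K ^ (3 / 2 : ℝ) * m ^ (3 / 2 : ℝ) := Real.mul_rpow hK0.le hm0.le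
        _ ≤ _ := by
          have : K ^ (3 / 2 : ℝ) ≤ K ^ 2 := by
            rw [← Real.rpow_natCast]
            exact Real.rpow_le_rpow_of_exponent_le hK (by norm_num)
          gcongr
    calc v ≤ 600 * ((P.H d * P.opt) ^ (3 / 2 : ℝ) *
            (Real.log d + Real.log (P.T n d / P.β)) *
            √(Real.log n * Real.log (1 / P.δ)) / (P.α ^ 2 * P.ε)) := hvs.trans (h.s_le hG1)
      _ ≤ 600 * (K ^ 2 * m ^ (3 / 2 : ℝ) *
            ((10 + 2 * K) * (Real.log d + Real.log (n / (P.α * P.β)))) *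
            √(Real.log n * Real.log (1 / P.δ)) / (P.α ^ 2 * P.ε)) := by gcongr
      _ = 600 * K ^ 2 * (10 + 2 * K) * (m ^ (3 / 2 : ℝ) *
            (Real.log d + Real.log (n / (P.α * P.β))) *
            √(Real.log n * Real.log (1 / P.δ)) / (P.α ^ 2 * P.ε)) := by ring
      _ ≤ _ := mul_le_mul_of_nonneg_right (by linarith) hX
  · have hE0 : 0 < E := by linarith
    have hsqrt : P.ε / (2 * E) ≤ √(Real.log n * Real.log (1 / P.δ)) := by
      refine Real.le_sqrt_of_sq_le ?_
      calc (P.ε / (2 * E)) ^ 2 ≤ P.ε / 4 := by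
            rw [div_pow, div_le_iff₀ (by positivity)]
            nlinarith [mul_le_mul hεE hE zero_le_one hE0.le]
        _ = 1 / 2 * (P.ε / 2) := by ring
        _ ≤ _ := by
            gcongr
            linarith
    have hpow : (n : ℝ) ≤ m ^ (3 / 2 : ℝ) := by
      calc (n : ℝ) ≤ m ^ (1 : ℝ) := by rwa [Real.rpow_one]
        _ ≤ _ := Real.rpow_le_rpow_of_exponent_le hm (by norm_num)
    have hα2 : P.α ^ 2 ≤ 1 := pow_le_one₀ hα.le h.α_lt.le
    calc v ≤ n := hvn
      _ = 4 * E * (n * (1 / 2) * (P.ε / (2 * E)) / (1 * P.ε)) := by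
          field_simp
          norm_num
      _ ≤ 4 * E * (m ^ (3 / 2 : ℝ) * (Real.log d + Real.log (n / (P.α * P.β))) *
            √(Real.log n * Real.log (1 / P.δ)) / (P.α ^ 2 * P.ε)) := by
          gcongr
          linarith
      _ ≤ _ := by
          refine mul_le_mul_of_nonneg_right ?_ hX
          have : 0 ≤ 600 * K ^ 2 * (10 + 2 * K) := by positivity
          linarith

end Bounds

lemma entriesIn_preprocess {P : Params} {n d : ℕ} (hp : P.processing = true) (hH : 0 ≤ P.H d)
    {A : Matrix (Fin n) (Fin d) ℝ} (hA : ∀ i j, 0 ≤ A i j) :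
    EntriesIn (P.H d) (preprocess P A) := fun i j => by
  simp only [preprocess, hp, if_true, Matrix.map_apply]
  exact ⟨le_min (hA i j) hH, min_le_right _ _⟩

lemma Neighbor.preprocess {P : Params} {n d : ℕ} {A A' : Matrix (Fin n) (Fin d) ℝ}
    (h : Neighbor A A') : Neighbor (preprocess P A) (preprocess P A') := by
  obtain ⟨i, hi⟩ := h
  refine ⟨i, fun k hk => ?_⟩
  unfold PackingLP.preprocess
  split_ifs
  · funext j
    simp [Matrix.map_apply, hi k hk]
  · exact hi k hk

end PackingLP

/-! ### Assembly of the two cases -/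

theorem theorem3 :
    -- without pre- and post-processing
    (∀ ε₀ κ : ℝ, ∃ C : ℝ, 0 < C ∧
      ∀ (n d : ℕ) [NeZero d] (α β ε δ : ℝ), 2 ≤ n → 0 < α → α < 1 → 0 < β → β < 1 →
        0 < ε → ε ≤ ε₀ → 0 < δ → δ < 1 → ε ≤ 2 * Real.log (1 / δ) →
        (∀ S opt : ℝ, 0 < S → 0 < opt →
          PackingLP.DifferentiallyPrivate ε δ
            {A : Matrix (Fin n) (Fin d) ℝ | ∀ i j, 0 ≤ A i j ∧ A i j ≤ S}
            (PackingLP.algorithm ⟨S, opt, α, β, ε, δ, false⟩)) ∧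
        (∀ (A : Matrix (Fin n) (Fin d) ℝ) (S opt : ℝ), (∀ i j, 0 ≤ A i j) →
          PackingLP.IsOpt A opt → (∀ i j, A i j ≤ S) → S ≤ κ * PackingLP.maxEntry A →
          (∀ x ∈ (PackingLP.algorithm ⟨S, opt, α, β, ε, δ, false⟩ A).support,
            (∀ j, 0 ≤ x j) ∧ (1 - α) * opt ≤ ∑ j, x j) ∧
          ENNReal.ofReal (1 - β) ≤
            (PackingLP.algorithm ⟨S, opt, α, β, ε, δ, false⟩ A).toOuterMeasure
              {x | (PackingLP.numViolated A α x : ℝ) ≤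
                  PackingLP.Params.s ⟨S, opt, α, β, ε, δ, false⟩ n d ∧
                (PackingLP.numViolated A α x : ℝ) ≤
                  C * ((PackingLP.maxEntry A * opt) ^ (3 / 2 : ℝ) *
                    (Real.log d + Real.log (n / (α * β))) *
                    √(Real.log n * Real.log (1 / δ)) / (α ^ 2 * ε))})) ∧
    -- with pre- and post-processing
    (∃ C : ℝ, 0 < C ∧
      ∀ (n d : ℕ) [NeZero d] (α β ε δ : ℝ), 2 ≤ n → 0 < α → α < 1 → 0 < β → β < 1 →
        0 < ε → 0 < δ → δ < 1 →
        (ε ≤ 2 * Real.log (1 / δ) → ∀ S opt : ℝ, 0 < opt →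
          PackingLP.DifferentiallyPrivate ε δ
            {A : Matrix (Fin n) (Fin d) ℝ | ∀ i j, 0 ≤ A i j}
            (PackingLP.algorithm ⟨S, opt, α, β, ε, δ, true⟩)) ∧
        (∀ (A : Matrix (Fin n) (Fin d) ℝ) (S opt : ℝ), (∀ i j, 0 ≤ A i j) →
          PackingLP.IsOpt A opt →
          (∀ x ∈ (PackingLP.algorithm ⟨S, opt, α, β, ε, δ, true⟩ A).support,
            (∀ j, 0 ≤ x j) ∧ (1 - α) * opt ≤ ∑ j, x j) ∧
          ENNReal.ofReal (1 - β) ≤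
            (PackingLP.algorithm ⟨S, opt, α, β, ε, δ, true⟩ A).toOuterMeasure
              {x | (PackingLP.numViolated A α x : ℝ) ≤
                  PackingLP.Params.s ⟨S, opt, α, β, ε, δ, true⟩ n d ∧
                (PackingLP.numViolated A α x : ℝ) ≤
                  C * ((d : ℝ) ^ (3 / 2 : ℝ) *
                    (Real.log d + Real.log (n / (α * β))) *
                    √(Real.log n * Real.log (1 / δ)) / (α ^ (7 / 2 : ℝ) * ε))})) := by
  constructor
  · intro ε₀ κ
    -- ε₀ and κ are arbitrary reals; raising both to at least 1 meets the requirements of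
    -- `le_of_le_s_of_le_card`.
    set E := max ε₀ 1
    set K := max κ 1
    have hE : 1 ≤ E := le_max_right _ _
    have hK : 1 ≤ K := le_max_right _ _
    refine ⟨4 * E + 600 * K ^ 2 * (10 + 2 * K), by positivity, ?_⟩
    intro n d _ α β ε δ hn hα hα1 hβ hβ1 hε hε₀ hδ hδ1 hεδ
    constructor
    · intro S opt hS hopt A hA A' hA' hN O
      exact PackingLP.algorithm_toOuterMeasure_le (P := ⟨S, opt, α, β, ε, δ, false⟩)
        ⟨hn, hS, hopt, hα, hα1, hβ, hβ1, hε, hδ, hδ1⟩ hεδ hA hA' hN O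
    · intro A S opt hA hopt hAS hSκ
      have hM := hopt.maxEntry_pos
      have hMS : PackingLP.maxEntry A ≤ S := by
        have : Nonempty (Fin n × Fin d) := ⟨(⟨0, by omega⟩, 0)⟩
        exact ciSup_le fun p => hAS p.1 p.2
      have hv : PackingLP.Params.Valid ⟨S, opt, α, β, ε, δ, false⟩ n d :=
        ⟨hn, hM.trans_le hMS, hopt.pos, hα, hα1, hβ, hβ1, hε, hδ, hδ1⟩
      refine ⟨fun x hx => PackingLP.nonneg_and_sum_of_mem_support_algorithm hv hx, ?_⟩
      refine (PackingLP.le_toOuterMeasure_numViolated_le hv hA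
        (fun i j => ⟨hA i j, hAS i j⟩) hopt).trans (MeasureTheory.measure_mono fun x hx => ?_)
      refine ⟨hx, PackingLP.le_of_le_s_of_le_card hv hE hK (hε₀.trans (le_max_left _ _)) hεδ
        hopt.one_le_maxEntry_mul (mul_le_mul_of_nonneg_right hMS hopt.pos.le) ?_ hx
        (by exact_mod_cast PackingLP.numViolated_le_card A α x)⟩
      rw [← mul_assoc]
      refine mul_le_mul_of_nonneg_right (hSκ.trans ?_) hopt.pos.le
      exact mul_le_mul_of_nonneg_right (le_max_left _ _) hM.le
  · refine ⟨36000, by norm_num, ?_⟩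
    intro n d _ α β ε δ hn hα hα1 hβ hβ1 hε hδ hδ1
    have hH : ∀ S opt : ℝ, 0 < opt →
        0 < PackingLP.Params.H ⟨S, opt, α, β, ε, δ, true⟩ d := fun S opt hopt => by
      have : (0 : ℝ) < d := by exact_mod_cast NeZero.pos d
      simp only [PackingLP.Params.H, if_true]
      positivity
    constructor
    · intro hεδ S opt hopt A hA A' hA' hN O
      exact PackingLP.algorithm_toOuterMeasure_le (P := ⟨S, opt, α, β, ε, δ, true⟩)
        ⟨hn, hH S opt hopt, hopt, hα, hα1, hβ, hβ1, hε, hδ, hδ1⟩ hεδ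
        (PackingLP.entriesIn_preprocess rfl (hH S opt hopt).le hA)
        (PackingLP.entriesIn_preprocess rfl (hH S opt hopt).le hA') hN.preprocess O
    · intro A S opt hA hopt
      have hv : PackingLP.Params.Valid ⟨S, opt, α, β, ε, δ, true⟩ n d :=
        ⟨hn, hH S opt hopt.pos, hopt.pos, hα, hα1, hβ, hβ1, hε, hδ, hδ1⟩
      refine ⟨fun x hx => PackingLP.nonneg_and_sum_of_mem_support_algorithm hv hx, ?_⟩
      refine (PackingLP.le_toOuterMeasure_numViolated_le hv hA
        (PackingLP.entriesIn_preprocess rfl (hH S opt hopt.pos).le hA) hopt).trans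
        (MeasureTheory.measure_mono fun x hx => ?_)
      exact ⟨hx, le_trans hx (PackingLP.s_le_of_processing hv rfl)⟩
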